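/- Let $N\ge 1$ be an integer and let $-1\le\gamma<0$. For measurable $E\subseteq\mathbb R^N\times\mathbb R^N$ put $$\nu_\gamma(E)=\iint_{(x,y)\in E,\ x\ne y}|x-y|^{\gamma-N}\,dx\,dy\in[0,\infty],$$ and for measurable $u:\mathbb R^N\to\mathbb R$ and $\lambda>0$ put $$E_{\lambda,\gamma}[u]=\Big\{(x,y)\in\mathbb R^N\times\mathbb R^N:\ x\neq y,\ \frac{|u(x)-u(y)|}{|x-y|^{1+\gamma}}>\lambda\Big\}.$$ Let $\dot W^{1,1}(\mathbb R^N)$ be the space of locally integrable $u$ whose distributional gradient $\nabla u$ is in $L^1(\mathbb R^N)$, and let $W^{1,1}(\mathbb R^N)=\dot W^{1,1}(\mathbb R^N)\cap L^1(\mathbb R^N)$ with the norm $\|u\|_{L^1}+\|\nabla u\|_{L^1}$ (functions that agree almost everywhere being identified). (i) There is a $C^\infty$ function $u\in\dot W^{1,1}(\mathbb R^N)$ that is rapidly decreasing, i.e. $\sup_{x}|x|^k|u(x)|<\infty$ for every integer $k\ge 0$, such that $$\lim_{\lambda\to0^+}\lambda\,\nu_\gamma(E_{\lambda,\gamma}[u])=\infty.\qquad(*)$$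 (ii) There is a compactly supported $u\in W^{1,1}(\mathbb R^N)$ for which $(*)$ holds. Moreover, the set $$\Big\{u\in W^{1,1}(\mathbb R^N):\ \limsup_{\lambda\to0^+}\lambda\,\nu_\gamma(E_{\lambda,\gamma}[u])<\infty\Big\}$$ is meager (of first category in the sense of Baire) in $W^{1,1}(\mathbb R^N)$. (iii) Suppose in addition that $N\ge 2$ or $\gamma>-1$. Then there is a compactly supported $u\in W^{1,1}(\mathbb R^N)$ such that $\nu_\gamma(E_{\lambda,\gamma}[u])=\infty$ for every $\lambda>0$. Moreover, the set $$\big\{u\in W^{1,1}(\mathbb R^N):\ \nu_\gamma(E_{\lambda,\gamma}[u])<\infty\ \text{for some}\ \lambda\in(0,\infty)\big\}$$ is meager in $W^{1,1}(\mathbb R^N)$. -/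

import Mathlib

open MeasureTheory Filter Topology
open scoped ENNReal ContDiff

noncomputable section

namespace SobolevCounterexamples

/-- `ℝ^N` with its Euclidean norm. -/
abbrev Eu (N : ℕ) : Type := EuclideanSpace ℝ (Fin N)

/-- The measure `ν_γ` on `ℝ^N × ℝ^N`: density `|x - y|^(γ - N)` with respect to Lebesgue measure
off the diagonal. -/
def nu (N : ℕ) (γ : ℝ) : Measure (Eu N × Eu N) :=
  (volume.restrict {p : Eu N × Eu N | p.1 ≠ p.2}).withDensity
    fun p => ENNReal.ofReal (‖p.1 - p.2‖ ^ (γ - (N : ℝ)))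

/-- The difference quotient `Q_b u (x, y) = (u x - u y) / |x - y|^(1 + b)`. -/
def Q {N : ℕ} (b : ℝ) (u : Eu N → ℝ) (x y : Eu N) : ℝ :=
  (u x - u y) / ‖x - y‖ ^ (1 + b)

/-- The superlevel set `E_{lam, b}[u]`. -/
def superlevel {N : ℕ} (lam b : ℝ) (u : Eu N → ℝ) : Set (Eu N × Eu N) :=
  {p | p.1 ≠ p.2 ∧ lam < |Q b u p.1 p.2|}

/-- `g` is the distributional gradient of `u`: for every test function `φ` and direction `v`,
`∫ u ∂_v φ = - ∫ φ ⟨g, v⟩`. It is only used for locally integrable `u` and `g`. -/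
def HasWeakGradient {N : ℕ} (u : Eu N → ℝ) (g : Eu N → Eu N) : Prop :=
  ∀ φ : Eu N → ℝ, ContDiff ℝ ∞ φ → HasCompactSupport φ → ∀ v : Eu N,
    ∫ x, u x * fderiv ℝ φ x v = - ∫ x, φ x * inner ℝ (g x) v

/-- Membership in the homogeneous Sobolev space `Ẇ^{1,1}(ℝ^N)`. -/
def MemHomW11 {N : ℕ} (u : Eu N → ℝ) : Prop :=
  LocallyIntegrable u ∧ ∃ g : Eu N → Eu N, Integrable g ∧ HasWeakGradient u g

/-- Membership in the inhomogeneous Sobolev space `W^{1,1}(ℝ^N)`. -/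
def MemW11 {N : ℕ} (u : Eu N → ℝ) : Prop :=
  MemHomW11 u ∧ Integrable u

theorem HasWeakGradient.congr {N : ℕ} {u u' : Eu N → ℝ} {g g' : Eu N → Eu N}
    (hu : u =ᵐ[volume] u') (hg : g =ᵐ[volume] g') (h : HasWeakGradient u g) :
    HasWeakGradient u' g' := by
  intro φ hφ hc v
  have h1 : ∫ x, u' x * fderiv ℝ φ x v = ∫ x, u x * fderiv ℝ φ x v :=
    integral_congr_ae (by filter_upwards [hu] with x hx; rw [hx])
  have h2 : ∫ x, φ x * inner ℝ (g' x) v = ∫ x, φ x * inner ℝ (g x) v :=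
    integral_congr_ae (by filter_upwards [hg] with x hx; rw [hx])
  rw [h1, h2]
  exact h φ hφ hc v

theorem integrable_mul_fderiv {N : ℕ} {u φ : Eu N → ℝ} (hu : LocallyIntegrable u)
    (hφ : ContDiff ℝ ∞ φ) (hc : HasCompactSupport φ) (v : Eu N) :
    Integrable fun x => u x * fderiv ℝ φ x v := by
  have hcont : Continuous fun x => fderiv ℝ φ x v :=
    (hφ.continuous_fderiv (by simp)).clm_apply continuous_const
  exact hu.integrable_smul_right_of_hasCompactSupport hcont (hc.fderiv_apply (𝕜 := ℝ) v)

theorem integrable_mul_inner {N : ℕ} {g : Eu N → Eu N} {φ : Eu N → ℝ} (hg : Integrable g)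
    (hφ : ContDiff ℝ ∞ φ) (hc : HasCompactSupport φ) (v : Eu N) :
    Integrable fun x => φ x * inner ℝ (g x) v :=
  (hg.inner_const v).locallyIntegrable.integrable_smul_left_of_hasCompactSupport hφ.continuous hc

theorem HasWeakGradient.add {N : ℕ} {u₁ u₂ : Eu N → ℝ} {g₁ g₂ : Eu N → Eu N}
    (hu₁ : LocallyIntegrable u₁) (hu₂ : LocallyIntegrable u₂)
    (hg₁ : Integrable g₁) (hg₂ : Integrable g₂)
    (h₁ : HasWeakGradient u₁ g₁) (h₂ : HasWeakGradient u₂ g₂) :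
    HasWeakGradient (u₁ + u₂) (g₁ + g₂) := by
  intro φ hφ hc v
  simp only [Pi.add_apply, add_mul, mul_add, inner_add_left]
  rw [integral_add (integrable_mul_fderiv hu₁ hφ hc v) (integrable_mul_fderiv hu₂ hφ hc v),
    integral_add (integrable_mul_inner hg₁ hφ hc v) (integrable_mul_inner hg₂ hφ hc v),
    h₁ φ hφ hc v, h₂ φ hφ hc v]
  ring

theorem HasWeakGradient.smul {N : ℕ} {u : Eu N → ℝ} {g : Eu N → Eu N} (c : ℝ)
    (h : HasWeakGradient u g) : HasWeakGradient (c • u) (c • g) := by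
  intro φ hφ hc v
  have h1 : ∀ x, (c • u) x * fderiv ℝ φ x v = c * (u x * fderiv ℝ φ x v) := fun x => by
    simp only [Pi.smul_apply, smul_eq_mul]; ring
  have h2 : ∀ x, φ x * inner ℝ ((c • g) x) v = c * (φ x * inner ℝ (g x) v) := fun x => by
    simp only [Pi.smul_apply, real_inner_smul_left]; ring
  simp only [h1, h2, integral_const_mul, h φ hφ hc v]
  ring

/-- The Banach space `W^{1,1}(ℝ^N)`, realised as the space of pairs `(u, ∇u)` in `L¹ × L¹`; its norm
is `‖u‖_{L¹} + ‖∇u‖_{L¹}`. The weak gradient is determined by `u`, so that this is the space of all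
(classes of) `u ∈ L¹` with distributional gradient in `L¹`. -/
def W11 (N : ℕ) :
    Submodule ℝ (WithLp 1 (Lp ℝ 1 (volume : Measure (Eu N)) × Lp (Eu N) 1 (volume : Measure (Eu N))))
    where
  carrier := {p | HasWeakGradient (p.fst : Eu N → ℝ) (p.snd : Eu N → Eu N)}
  zero_mem' := by
    refine HasWeakGradient.congr (Lp.coeFn_zero ℝ 1 volume).symm
      (Lp.coeFn_zero (Eu N) 1 volume).symm ?_
    intro φ _ _ v
    simp
  add_mem' := by
    intro p q hp hq
    have ip := L1.integrable_coeFn p.fst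
    have iq := L1.integrable_coeFn q.fst
    refine HasWeakGradient.congr (Lp.coeFn_add p.fst q.fst).symm
      (Lp.coeFn_add p.snd q.snd).symm ?_
    exact HasWeakGradient.add ip.locallyIntegrable iq.locallyIntegrable
      (L1.integrable_coeFn p.snd) (L1.integrable_coeFn q.snd) hp hq
  smul_mem' := by
    intro c p hp
    exact HasWeakGradient.congr (Lp.coeFn_smul c p.fst).symm (Lp.coeFn_smul c p.snd).symm
      (HasWeakGradient.smul c hp)

/-- A function representing an element of `W^{1,1}(ℝ^N)`. -/
def W11.toFun {N : ℕ} (U : W11 N) : Eu N → ℝ :=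
  ((U : WithLp 1 (Lp ℝ 1 (volume : Measure (Eu N)) × Lp (Eu N) 1 (volume : Measure (Eu N)))).fst :
    Eu N → ℝ)

/-- `u` decreases at infinity faster than every power of `|x|`. -/
def RapidlyDecreasing {N : ℕ} (u : Eu N → ℝ) : Prop :=
  ∀ k : ℕ, ∃ C : ℝ, ∀ x : Eu N, ‖x‖ ^ k * |u x| ≤ C

/-- `lam ν_γ(E_{lam, γ}[u])`, as an extended nonnegative number. -/
def levelFunctional {N : ℕ} (γ : ℝ) (u : Eu N → ℝ) (lam : ℝ) : ℝ≥0∞ :=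
  ENNReal.ofReal lam * nu N γ (superlevel lam γ u)

end SobolevCounterexamples

end

noncomputable section

namespace SobolevCounterexamples

/-! Everything rests on bumps whose `W^{1,1}` norm stays bounded while `ν_γ` of one fixed superlevel
set is as large as desired (`exists_bump`). Take a smooth approximation of the Cantor function with
`M` branches and ratio `ρ`, where `M ρ^(1+γ) = 1`, i.e. of dimension `1 + γ ∈ [0, 1)`, apply it to
one coordinate and cut it off. Monotonicity bounds the gradient independently of the depth. Across
each of the `M^j` intervals of generation `j`, of length `r = ρ^j`, the function grows by at least
`M^(-j) = r^(1+γ)`, so pairs of points on the two sides at distance comparable to `r` have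
difference quotient bounded below. Each generation of such pairs has `ν_γ` measure at least a fixed
constant, and generations are disjoint, so the measure grows linearly with the depth
(`nu_cells_ge`).

The rescaled bump `A f((x - z)/r)` has gradient norm of order `A r^(N-1)`, its level is multiplied
by `A / r^(1+γ)`, and the measure by `r^(N+γ)`. Only the first two matter, since the depth can
absorb the third. Disjoint bumps with summable `A r^(N-1)` add up to the counterexamples
(`exists_superposition`): unit radii with centres going to infinity for (i), shrinking radii and
levels tending to `0` for (ii), levels tending to infinity for (iii). The last choice needs `A /
r^(1+γ)` unbounded with `A r^(N-1)` summable, which is where `N + γ > 0` enters.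

For meagreness, the bad sets are covered by countably many sets cut out by bounds on `ν_γ`. These
are closed by a Fatou argument (`isClosed_setOf_nu_superlevel_le`). They have empty interior because
adding a small multiple of a counterexample to any member breaks a bound
(`isNowhereDense_setOf_nu_superlevel_le`). -/

/-! ### Smooth Cantor-type steps -/

/-- Smooth approximations of the Cantor function with `M` branches and contraction ratio `ρ`. -/
def ladder (M : ℕ) (ρ : ℝ) : ℕ → ℝ → ℝ
  | 0 => Real.smoothTransition
  | k + 1 => fun x => (1 / M : ℝ) * ∑ i ∈ Finset.range M, ladder M ρ k ((x - i / M) / ρ)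

/-- The left end points of the intervals of the `j`-th generation of the Cantor construction,
indexed by `n < M ^ j`. -/
def ladderPt (M : ℕ) (ρ : ℝ) : ℕ → ℕ → ℝ
  | 0, _ => 0
  | j + 1, n => ((n % M : ℕ) : ℝ) / M + ρ * ladderPt M ρ j (n / M)

section Ladder

variable {M : ℕ} {ρ : ℝ}

theorem ladder_contDiff (M : ℕ) (ρ : ℝ) (k : ℕ) : ContDiff ℝ ∞ (ladder M ρ k) := by
  induction k with
  | zero => exact Real.smoothTransition.contDiff
  | succ k ih =>
    refine contDiff_const.mul (ContDiff.sum fun i _ => ih.comp ?_)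
    exact (contDiff_id.sub contDiff_const).div_const _

theorem ladder_monotone (hρ : 0 < ρ) (k : ℕ) : Monotone (ladder M ρ k) := by
  induction k with
  | zero => exact Real.smoothTransition.monotone
  | succ k ih =>
    intro x y hxy
    refine mul_le_mul_of_nonneg_left (Finset.sum_le_sum fun i _ => ih ?_) (by positivity)
    gcongr

theorem ladder_of_nonpos (hρ : 0 < ρ) (k : ℕ) {x : ℝ} (hx : x ≤ 0) : ladder M ρ k x = 0 := by
  induction k generalizing x with
  | zero => exact Real.smoothTransition.zero_of_nonpos hx
  | succ k ih =>
    have : ∑ i ∈ Finset.range M, ladder M ρ k ((x - i / M) / ρ) = 0 := by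
      refine Finset.sum_eq_zero fun i _ => ih ?_
      refine div_nonpos_of_nonpos_of_nonneg ?_ hρ.le
      have : (0 : ℝ) ≤ i / M := by positivity
      linarith
    simp [ladder, this]

theorem ladder_of_one_le (hρ : 0 < ρ) (hM : 1 ≤ M) (hMρ : 3 * M * ρ ≤ 1) (k : ℕ) {x : ℝ}
    (hx : 1 ≤ x) : ladder M ρ k x = 1 := by
  have hM' : (0 : ℝ) < M := by exact_mod_cast hM
  induction k generalizing x with
  | zero => exact Real.smoothTransition.one_of_one_le hx
  | succ k ih =>
    have : ∑ i ∈ Finset.range M, ladder M ρ k ((x - i / M) / ρ) = ∑ i ∈ Finset.range M, 1 := by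
      refine Finset.sum_congr rfl fun i hi => ih ?_
      have hi' : (i : ℝ) + 1 ≤ M := by exact_mod_cast Finset.mem_range.1 hi
      rw [le_div_iff₀ hρ, one_mul, le_sub_iff_add_le, ← sub_nonneg]
      have : 0 ≤ (x - (ρ + i / M)) * M := by
        field_simp
        nlinarith
      exact nonneg_of_mul_nonneg_left this hM'
    simp only [ladder, this]
    simp [hM'.ne']

theorem ladder_nonneg (hρ : 0 < ρ) (k : ℕ) (x : ℝ) : 0 ≤ ladder M ρ k x := by
  rcases le_total x 0 with h | h
  · rw [ladder_of_nonpos hρ k h]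
  · rw [← ladder_of_nonpos (M := M) hρ k le_rfl]
    exact ladder_monotone hρ k h

theorem ladder_le_one (hρ : 0 < ρ) (hM : 1 ≤ M) (hMρ : 3 * M * ρ ≤ 1) (k : ℕ) (x : ℝ) :
    ladder M ρ k x ≤ 1 := by
  rcases le_total 1 x with h | h
  · rw [ladder_of_one_le hρ hM hMρ k h]
  · rw [← ladder_of_one_le hρ hM hMρ k le_rfl]
    exact ladder_monotone hρ k h

theorem ladderPt_nonneg (hρ : 0 < ρ) (j n : ℕ) : 0 ≤ ladderPt M ρ j n := by
  induction j generalizing n with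
  | zero => simp [ladderPt]
  | succ j ih => have := ih (n / M); simp only [ladderPt]; positivity

theorem ladderPt_add_le (hρ : 0 < ρ) (hM : 1 ≤ M) (hMρ : 3 * M * ρ ≤ 1) (j n : ℕ) :
    ladderPt M ρ j n + ρ ^ j ≤ 1 := by
  have hM' : (0 : ℝ) < M := by exact_mod_cast hM
  induction j generalizing n with
  | zero => simp [ladderPt]
  | succ j ih =>
    have h1 := ih (n / M)
    have h2 : ((n % M : ℕ) : ℝ) + 1 ≤ M := by exact_mod_cast Nat.mod_lt n (by omega)
    have h3 : ((n % M : ℕ) : ℝ) / M ≤ 1 - 1 / M := by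
      rw [div_le_iff₀ hM']; field_simp; linarith
    have h4 : 3 * ρ ≤ 1 / M := by rw [le_div_iff₀ hM']; linarith
    simp only [ladderPt, pow_succ']
    nlinarith

/-- The base-`M` digits of the index, least significant first, are the branches chosen from the
coarsest generation down. If the first digits agree, rescale and induct; otherwise the points
already lie in different first-generation intervals. -/
theorem ladderPt_separated (hρ : 0 < ρ) (hM : 1 ≤ M) (hMρ : 3 * M * ρ ≤ 1) (j : ℕ) {n m : ℕ}
    (hn : n < M ^ j) (hm : m < M ^ j) (hnm : n ≠ m) :
    ρ ^ j ≤ |ladderPt M ρ j n - ladderPt M ρ j m| := by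
  have hM' : (0 : ℝ) < M := by exact_mod_cast hM
  have h4 : 3 * ρ ≤ 1 / M := by rw [le_div_iff₀ hM']; linarith
  have hρ1 : ρ ≤ 1 := by
    have : (1 : ℝ) ≤ M := by exact_mod_cast hM
    nlinarith
  induction j generalizing n m with
  | zero => simp at hn hm; omega
  | succ j ih =>
    simp only [ladderPt]
    by_cases h : n % M = m % M
    · have hne : n / M ≠ m / M := fun h' => hnm (by
        rw [← Nat.div_add_mod n M, ← Nat.div_add_mod m M, h, h'])
      have hn' : n / M < M ^ j := Nat.div_lt_of_lt_mul (by rwa [← pow_succ'])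
      have hm' : m / M < M ^ j := Nat.div_lt_of_lt_mul (by rwa [← pow_succ'])
      rw [h, add_sub_add_left_eq_sub, ← mul_sub, abs_mul, abs_of_pos hρ, pow_succ']
      exact mul_le_mul_of_nonneg_left (ih hn' hm' hne) hρ.le
    · have h5 : 1 / (M : ℝ) ≤ |((n % M : ℕ) : ℝ) / M - ((m % M : ℕ) : ℝ) / M| := by
        rw [← sub_div, abs_div, abs_of_pos hM']
        gcongr
        have : (1 : ℤ) ≤ |((n % M : ℕ) : ℤ) - ((m % M : ℕ) : ℤ)| :=
          Int.one_le_abs (sub_ne_zero.2 (by exact_mod_cast h))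
        exact_mod_cast this
      have h6 : |ladderPt M ρ j (n / M) - ladderPt M ρ j (m / M)| ≤ 1 := by
        have a1 := ladderPt_nonneg (M := M) hρ j (n / M)
        have a2 := ladderPt_nonneg (M := M) hρ j (m / M)
        have a3 := ladderPt_add_le hρ hM hMρ j (n / M)
        have a4 := ladderPt_add_le hρ hM hMρ j (m / M)
        have a5 : 0 < ρ ^ j := by positivity
        rw [abs_le]; constructor <;> linarith
      have h7 : ρ ^ (j + 1) ≤ ρ := by
        rw [pow_succ]; exact mul_le_of_le_one_left hρ.le (pow_le_one₀ hρ.le hρ1)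
      -- Reverse triangle inequality: the first digits contribute at least `1/M ≥ 3ρ` and the
      -- remaining ones at most `ρ`, which leaves `2ρ ≥ ρ^(j+1)`.
      have h8 := abs_sub_abs_le_abs_sub (((n % M : ℕ) : ℝ) / M - ((m % M : ℕ) : ℝ) / M)
        (-(ρ * (ladderPt M ρ j (n / M) - ladderPt M ρ j (m / M))))
      rw [abs_neg, abs_mul, abs_of_pos hρ] at h8
      have h9 : ((n % M : ℕ) : ℝ) / M - ((m % M : ℕ) : ℝ) / M -
          -(ρ * (ladderPt M ρ j (n / M) - ladderPt M ρ j (m / M))) =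
          ((n % M : ℕ) : ℝ) / M + ρ * ladderPt M ρ j (n / M) -
          (((m % M : ℕ) : ℝ) / M + ρ * ladderPt M ρ j (m / M)) := by ring
      rw [h9] at h8
      nlinarith

/-- All `M` branches are nondecreasing, so the increment is at least `1/M` times that of the branch
containing the interval, namely branch `n % M`. Each generation thus costs one factor `1/M`. -/
theorem ladder_increment (hρ : 0 < ρ) (hM : 1 ≤ M) (hMρ : 3 * M * ρ ≤ 1) {k j : ℕ} (hjk : j ≤ k)
    (n : ℕ) {x y : ℝ} (hx : x ≤ ladderPt M ρ j n)
    (hy : ladderPt M ρ j n + ρ ^ j ≤ y) :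
    (1 / M : ℝ) ^ j ≤ ladder M ρ k y - ladder M ρ k x := by
  have hM' : (0 : ℝ) < M := by exact_mod_cast hM
  induction k generalizing j n x y with
  | zero =>
    obtain rfl : j = 0 := by omega
    simp only [ladderPt, pow_zero, zero_add] at hx hy
    rw [ladder_of_nonpos hρ 0 hx, ladder_of_one_le hρ hM hMρ 0 hy]; simp
  | succ k ih =>
    cases j with
    | zero =>
      simp only [ladderPt, pow_zero, zero_add] at hx hy
      rw [ladder_of_nonpos hρ _ hx, ladder_of_one_le hρ hM hMρ _ hy]; simp
    | succ j =>
      simp only [ladderPt] at hx hy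
      have hxy : x ≤ y := by
        have : 0 < ρ ^ (j + 1) := by positivity
        linarith
      have key := ih (j := j) (by omega) (n / M) (x := (x - (n % M : ℕ) / M) / ρ)
        (y := (y - (n % M : ℕ) / M) / ρ) (by rw [div_le_iff₀ hρ]; linarith)
        (by rw [le_div_iff₀ hρ]; rw [pow_succ] at hy; linarith)
      have hsum : ladder M ρ k ((y - (n % M : ℕ) / M) / ρ) - ladder M ρ k ((x - (n % M : ℕ) / M) / ρ)
          ≤ ∑ i ∈ Finset.range M, (ladder M ρ k ((y - i / M) / ρ) - ladder M ρ k ((x - i / M) / ρ)) :=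
        Finset.single_le_sum (f := fun i : ℕ => ladder M ρ k ((y - i / M) / ρ)
            - ladder M ρ k ((x - i / M) / ρ))
          (fun i _ => sub_nonneg.2 (ladder_monotone hρ k (by gcongr)))
          (Finset.mem_range.2 (Nat.mod_lt n (by omega)))
      simp only [ladder]
      rw [← mul_sub, ← Finset.sum_sub_distrib, pow_succ']
      exact mul_le_mul_of_nonneg_left (key.trans hsum) (by positivity)

end Ladder

/-- For `0 ≤ s < 1` there are a branching number and a ratio with similarity dimension `s`. -/
theorem exists_ladder_parameters {s : ℝ} (hs : 0 ≤ s) (hs1 : s < 1) :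
    ∃ (M : ℕ) (ρ : ℝ), 1 ≤ M ∧ 0 < ρ ∧ 3 * M * ρ < 1 ∧ (M : ℝ) * ρ ^ s = 1 := by
  rcases hs.eq_or_lt with rfl | hs0
  -- Dimension `0`, the case `γ = -1`: with a single branch the ladder is one steep step, and any
  -- ratio below `1/3` would do.
  · exact ⟨1, 1 / 4, le_rfl, by norm_num, by norm_num, by simp⟩
  -- The equation forces `ρ = M^(-1/s)`; then `M ρ = M^(1 - 1/s)` tends to `0` because `s < 1`.
  · have h1 : Tendsto (fun n : ℕ => (n : ℝ) ^ (-(1 / s - 1))) atTop (𝓝 0) :=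
      (tendsto_rpow_neg_atTop (sub_pos.2 ((one_lt_div hs0).2 hs1))).comp tendsto_natCast_atTop_atTop
    obtain ⟨M, hM, hM1⟩ := ((h1.eventually (gt_mem_nhds (show (0 : ℝ) < 1 / 3 by norm_num))).and
      (eventually_ge_atTop 1)).exists
    have hM' : (0 : ℝ) < M := by exact_mod_cast hM1
    refine ⟨M, (M : ℝ) ^ (-(1 / s)), hM1, by positivity, ?_, ?_⟩
    · have : (M : ℝ) * (M : ℝ) ^ (-(1 / s)) = (M : ℝ) ^ (-(1 / s - 1)) := by
        rw [show -(1 / s - 1) = 1 + -(1 / s) by ring, Real.rpow_add hM', Real.rpow_one]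
      rw [mul_assoc, this]; linarith
    · rw [← Real.rpow_mul hM'.le, show -(1 / s) * s = -1 by field_simp, Real.rpow_neg_one]
      exact mul_inv_cancel₀ hM'.ne'

/-! ### Lower bounds for `nu` on explicit cells -/

/-- A half-open box in `ℝ^N`. -/
def box {N : ℕ} (l u : Fin N → ℝ) : Set (Eu N) := {x | ∀ i, x i ∈ Set.Ioc (l i) (u i)}

theorem volume_box {N : ℕ} (l u : Fin N → ℝ) :
    volume (box l u) = ∏ i, ENNReal.ofReal (u i - l i) := by
  rw [← Real.volume_pi_Ioc,
    ← (EuclideanSpace.volume_preserving_symm_measurableEquiv_toLp (Fin N)).measure_preimage_equiv]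
  congr 1
  ext x
  simp [box]

/-- Pairs of points on the two sides of the slab `a ≤ x i₀ ≤ a + r`, at mutual distance of
order `r`. -/
def cell {N : ℕ} (i₀ : Fin N) (a r : ℝ) : Set (Eu N × Eu N) :=
  {p | p.1 ∈ box (fun i => if i = i₀ then a - r else 0) (fun i => if i = i₀ then a else 1) ∧
    p.2 ∈ box (fun i => if i = i₀ then a + r else p.1 i)
      (fun i => if i = i₀ then a + 2 * r else p.1 i + r)}

theorem measurableSet_cell {N : ℕ} (i₀ : Fin N) (a r : ℝ) : MeasurableSet (cell i₀ a r) := by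
  have e : cell i₀ a r = ⋂ i, {p : Eu N × Eu N |
      ((if i = i₀ then a - r else 0) < p.1 i ∧ p.1 i ≤ (if i = i₀ then a else 1)) ∧
      ((if i = i₀ then a + r else p.1 i) < p.2 i ∧
        p.2 i ≤ (if i = i₀ then a + 2 * r else p.1 i + r))} := by
    ext p
    simp only [cell, box, Set.mem_ofPred_eq, Set.mem_Ioc, Set.mem_iInter, forall_and]
  rw [e]
  refine MeasurableSet.iInter fun i => ?_
  have m1 : Measurable fun p : Eu N × Eu N => p.1 i := by fun_prop
  have m2 : Measurable fun p : Eu N × Eu N => p.2 i := by fun_prop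
  by_cases h : i = i₀
  · simp only [h, if_true]
    rw [h] at m1 m2
    exact ((measurableSet_lt measurable_const m1).inter (measurableSet_le m1 measurable_const)).inter
      ((measurableSet_lt measurable_const m2).inter (measurableSet_le m2 measurable_const))
  · simp only [h, if_false]
    exact ((measurableSet_lt measurable_const m1).inter (measurableSet_le m1 measurable_const)).inter
      ((measurableSet_lt m1 m2).inter (measurableSet_le m2 (m1.add measurable_const)))

theorem volume_cell {N : ℕ} (i₀ : Fin N) (a : ℝ) {r : ℝ} (hr : 0 ≤ r) :
    volume (cell i₀ a r) = ENNReal.ofReal (r ^ (N + 1)) := by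
  set X := box (fun i => if i = i₀ then a - r else 0) (fun i => if i = i₀ then a else 1) with hX
  have hXv : volume X = ENNReal.ofReal r := by
    rw [hX, volume_box, Finset.prod_eq_single i₀]
    · simp
    · intro i _ hi; simp [hi]
    · simp
  have hmeas : MeasurableSet X := by
    have e : X = ⋂ i, {x : Eu N | x i ∈
        Set.Ioc (if i = i₀ then a - r else 0) (if i = i₀ then a else 1)} := by
      ext; simp [hX, box]
    rw [e]
    refine MeasurableSet.iInter fun i => ?_
    have m1 : Measurable fun p : Eu N => p i := by fun_prop
    exact m1 measurableSet_Ioc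
  have hsec : ∀ x : Eu N, volume (Prod.mk x ⁻¹' cell i₀ a r) =
      X.indicator (fun _ => ENNReal.ofReal (r ^ N)) x := by
    intro x
    by_cases hx : x ∈ X
    · have : Prod.mk x ⁻¹' cell i₀ a r = box (fun i => if i = i₀ then a + r else x i)
          (fun i => if i = i₀ then a + 2 * r else x i + r) := by
        ext y; exact ⟨fun h => h.2, fun h => ⟨hx, h⟩⟩
      rw [this, volume_box, Set.indicator_of_mem hx]
      have : ∀ i : Fin N, ENNReal.ofReal ((if i = i₀ then a + 2 * r else x i + r) -
          (if i = i₀ then a + r else x i)) = ENNReal.ofReal r := by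
        intro i; split_ifs <;> congr 1 <;> ring
      simp [this, ENNReal.ofReal_pow hr]
    · have : Prod.mk x ⁻¹' cell i₀ a r = ∅ := by
        ext y; exact ⟨fun h => hx h.1, fun h => h.elim⟩
      rw [this, Set.indicator_of_notMem hx, measure_empty]
  rw [Measure.volume_eq_prod, Measure.prod_apply (measurableSet_cell i₀ a r)]
  simp only [hsec]
  rw [lintegral_indicator_const hmeas, hXv, ← ENNReal.ofReal_mul (by positivity), pow_succ]

/-- The density is nonincreasing in the distance, so on `S` it is at least its value at distance
`d`. -/
theorem le_nu {N : ℕ} {γ d : ℝ} (hγ : γ ≤ N) {S : Set (Eu N × Eu N)} (hS : MeasurableSet S)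
    (h : ∀ p ∈ S, p.1 ≠ p.2 ∧ ‖p.1 - p.2‖ ≤ d) :
    ENNReal.ofReal (d ^ (γ - N)) * volume S ≤ nu N γ S := by
  rw [nu, withDensity_apply _ hS, Measure.restrict_restrict hS]
  have : S ∩ {p : Eu N × Eu N | p.1 ≠ p.2} = S := by
    ext p; exact ⟨fun hp => hp.1, fun hp => ⟨hp, (h p hp).1⟩⟩
  rw [this, ← setLIntegral_const]
  refine setLIntegral_mono' hS fun p hp => ENNReal.ofReal_le_ofReal ?_
  exact Real.rpow_le_rpow_of_nonpos (norm_pos_iff.2 (sub_ne_zero.2 (h p hp).1)) (h p hp).2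
    (by linarith)

theorem norm_le_sum_abs {N : ℕ} (x : Eu N) : ‖x‖ ≤ ∑ i, |x i| := by
  have h : x = ∑ i, EuclideanSpace.single i (x i) := by
    ext j; simp [Finset.sum_apply]
  calc ‖x‖ = ‖∑ i, EuclideanSpace.single i (x i)‖ := by rw [← h]
    _ ≤ ∑ i, ‖EuclideanSpace.single i (x i)‖ := norm_sum_le _ _
    _ = ∑ i, |x i| := by simp

section Cell

variable {N : ℕ} {i₀ : Fin N} {a r : ℝ} {p : Eu N × Eu N}

theorem fst_coord_of_mem_cell (h : p ∈ cell i₀ a r) : p.1 i₀ ∈ Set.Ioc (a - r) a := by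
  simpa using h.1 i₀

theorem snd_coord_of_mem_cell (h : p ∈ cell i₀ a r) :
    p.2 i₀ ∈ Set.Ioc (a + r) (a + 2 * r) := by
  simpa using h.2 i₀

theorem norm_sub_le_of_mem_cell (h : p ∈ cell i₀ a r) :
    ‖p.1 - p.2‖ ≤ 3 * N * r := by
  refine (norm_le_sum_abs _).trans ?_
  have : ∀ i ∈ (Finset.univ : Finset (Fin N)), |(p.1 - p.2) i| ≤ 3 * r := by
    intro i _
    have h1 := h.1 i
    have h2 := h.2 i
    simp only [Set.mem_Ioc] at h1 h2
    simp only [PiLp.sub_apply, abs_le]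
    split_ifs at h1 h2 <;> constructor <;> linarith [h1.1, h1.2, h2.1, h2.2]
  refine (Finset.sum_le_card_nsmul _ _ _ this).trans ?_
  simp; linarith

theorem norm_le_of_mem_cell (hr1 : r ≤ 1) (ha : 0 ≤ a) (har : a + r ≤ 1)
    (h : p ∈ cell i₀ a r) : ‖p.1‖ ≤ 2 * N ∧ ‖p.2‖ ≤ 2 * N := by
  have key : ∀ i, |p.1 i| ≤ 2 ∧ |p.2 i| ≤ 2 := by
    intro i
    have h1 := h.1 i
    have h2 := h.2 i
    simp only [Set.mem_Ioc] at h1 h2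
    simp only [abs_le]
    split_ifs at h1 h2 <;> refine ⟨⟨?_, ?_⟩, ?_, ?_⟩ <;> linarith [h1.1, h1.2, h2.1, h2.2]
  constructor
  · refine (norm_le_sum_abs _).trans ((Finset.sum_le_card_nsmul _ _ 2 fun i _ => (key i).1).trans ?_)
    simp; linarith
  · refine (norm_le_sum_abs _).trans ((Finset.sum_le_card_nsmul _ _ 2 fun i _ => (key i).2).trans ?_)
    simp; linarith

end Cell

/-! ### Bumps with large superlevel sets -/

theorem mem_superlevel_iff {N : ℕ} {lam b : ℝ} {u : Eu N → ℝ} {p : Eu N × Eu N} :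
    p ∈ superlevel lam b u ↔ p.1 ≠ p.2 ∧ lam * ‖p.1 - p.2‖ ^ (1 + b) < |u p.1 - u p.2| := by
  refine and_congr_right fun h => ?_
  have h0 : 0 < ‖p.1 - p.2‖ ^ (1 + b) :=
    Real.rpow_pos_of_pos (norm_pos_iff.2 (sub_ne_zero.2 h)) _
  rw [Q, abs_div, abs_of_pos h0, lt_div_iff₀ h0]

/-- The union of the cells of the first `K` generations. -/
def cells {N : ℕ} (i₀ : Fin N) (M : ℕ) (ρ : ℝ) (K : ℕ) : Set (Eu N × Eu N) :=
  ⋃ q ∈ (Finset.range K).sigma (fun j => Finset.range (M ^ j)),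
    cell i₀ (ladderPt M ρ q.1 q.2) (ρ ^ q.1)

section Cells

variable {N : ℕ} {i₀ : Fin N} {M : ℕ} {ρ : ℝ}

/-- In a cell of size `r` the `i₀` coordinates of the two points differ by more than `r` and less
than `3r`. These ranges do not overlap for different generations, since `3ρ ≤ 1`. -/
theorem disjoint_cell_of_lt (hρ : 0 < ρ) (hρ3 : 3 * ρ ≤ 1) {j k : ℕ} (hjk : j < k) (a b : ℝ) :
    Disjoint (cell i₀ a (ρ ^ j)) (cell i₀ b (ρ ^ k)) := by
  rw [Set.disjoint_left]
  intro p hp hq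
  have h1 := fst_coord_of_mem_cell hp
  have h2 := snd_coord_of_mem_cell hp
  have h3 := fst_coord_of_mem_cell hq
  have h4 := snd_coord_of_mem_cell hq
  have h5 : ρ ^ k ≤ ρ ^ (j + 1) := pow_le_pow_of_le_one hρ.le (by linarith) hjk
  rw [pow_succ] at h5
  have h6 : 0 < ρ ^ j := by positivity
  nlinarith [h1.1, h1.2, h2.1, h2.2, h3.1, h3.2, h4.1, h4.2]

theorem disjoint_cell_of_ne (hρ : 0 < ρ) (hM : 1 ≤ M) (hMρ : 3 * M * ρ ≤ 1) {j n m : ℕ}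
    (hn : n < M ^ j) (hm : m < M ^ j) (hnm : n ≠ m) :
    Disjoint (cell i₀ (ladderPt M ρ j n) (ρ ^ j)) (cell i₀ (ladderPt M ρ j m) (ρ ^ j)) := by
  rw [Set.disjoint_left]
  intro p hp hq
  have h1 := fst_coord_of_mem_cell hp
  have h3 := fst_coord_of_mem_cell hq
  have h := ladderPt_separated hρ hM hMρ j hn hm hnm
  rcases le_abs.1 h with h | h <;> linarith [h1.1, h1.2, h3.1, h3.2]

/-- A cell of size `r = ρ^j` has volume `r^(N+1)` and density at least `(3Nr)^(γ-N)`, hence measure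
at least `(3N)^(γ-N) r^(1+γ)`. As `r^(1+γ) = M^(-j)`, the `M^j` cells of a generation contribute an
amount independent of `j`. -/
theorem nu_cells_ge {γ : ℝ} (hγ : γ ≤ N) (hρ : 0 < ρ) (hM : 1 ≤ M) (hMρ : 3 * M * ρ ≤ 1)
    (hdim : (M : ℝ) * ρ ^ (1 + γ) = 1) (K : ℕ) :
    ENNReal.ofReal (K * (3 * N : ℝ) ^ (γ - N)) ≤ nu N γ (cells i₀ M ρ K) := by
  have hM' : (0 : ℝ) < M := by exact_mod_cast hM
  have hN : (0 : ℝ) < N := by exact_mod_cast i₀.pos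
  have hρ3 : 3 * ρ ≤ 1 := by
    have : (1 : ℝ) ≤ M := by exact_mod_cast hM
    nlinarith
  rw [cells, measure_biUnion_finset]
  · rw [Finset.sum_sigma]
    have hcell : ∀ j n : ℕ, ENNReal.ofReal ((3 * N : ℝ) ^ (γ - N) * (1 / M : ℝ) ^ j) ≤
        nu N γ (cell i₀ (ladderPt M ρ j n) (ρ ^ j)) := by
      intro j n
      have hr : 0 < ρ ^ j := by positivity
      refine le_trans (le_of_eq ?_) (le_nu (d := 3 * N * ρ ^ j) hγ (measurableSet_cell _ _ _) ?_)
      · rw [volume_cell _ _ hr.le, ← ENNReal.ofReal_mul (by positivity)]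
        congr 1
        have e1 : (1 / M : ℝ) = ρ ^ (1 + γ) := by
          rw [div_eq_iff hM'.ne']; linarith
        rw [Real.mul_rpow (by positivity) hr.le, mul_assoc, e1, ← Real.rpow_natCast (ρ ^ j),
          ← Real.rpow_add hr, ← Real.rpow_natCast, ← Real.rpow_natCast, ← Real.rpow_mul hρ.le,
          ← Real.rpow_mul hρ.le]
        congr 2
        push_cast
        ring
      · intro p hp
        refine ⟨fun h => ?_, norm_sub_le_of_mem_cell hp⟩
        have h1 := fst_coord_of_mem_cell hp
        have h2 := snd_coord_of_mem_cell hp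
        rw [h] at h1
        linarith [h1.2, h2.1]
    have hlev : ∀ j ∈ Finset.range K, ENNReal.ofReal ((3 * N : ℝ) ^ (γ - N)) ≤
        ∑ n ∈ Finset.range (M ^ j), nu N γ (cell i₀ (ladderPt M ρ j n) (ρ ^ j)) := by
      intro j _
      refine le_trans (le_of_eq ?_) (Finset.sum_le_sum fun n _ => hcell j n)
      rw [Finset.sum_const, Finset.card_range, nsmul_eq_mul, ← ENNReal.ofReal_natCast,
        ← ENNReal.ofReal_mul (by positivity)]
      congr 1
      push_cast
      rw [mul_left_comm, ← mul_pow, mul_one_div_cancel hM'.ne', one_pow, mul_one]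
    refine le_trans (le_of_eq ?_) (Finset.sum_le_sum hlev)
    rw [Finset.sum_const, Finset.card_range, nsmul_eq_mul, ← ENNReal.ofReal_natCast,
        ← ENNReal.ofReal_mul (by positivity)]
  · rintro ⟨j, n⟩ hn ⟨k, m⟩ hm hne
    simp only [Finset.coe_sigma, Set.mem_sigma_iff, Finset.coe_range, Set.mem_Iio] at hn hm
    rcases lt_trichotomy j k with h | rfl | h
    · exact disjoint_cell_of_lt hρ hρ3 h _ _
    · exact disjoint_cell_of_ne hρ hM hMρ hn.2 hm.2 (fun h => hne (congrArg (Sigma.mk j) h))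
    · exact (disjoint_cell_of_lt hρ hρ3 h _ _).symm
  · exact fun _ _ => measurableSet_cell _ _ _

theorem cells_subset_superlevel {γ : ℝ} (hγ : -1 ≤ γ) (hγ0 : γ < 0) (hρ : 0 < ρ) (hM : 1 ≤ M)
    (hMρ : 3 * M * ρ ≤ 1) (hdim : (M : ℝ) * ρ ^ (1 + γ) = 1) (K : ℕ) {f : Eu N → ℝ}
    (hf : ∀ x : Eu N, ‖x‖ ≤ 2 * N → f x = ladder M ρ K (x i₀)) {R : ℝ} (hR : 2 * N < R) :
    cells i₀ M ρ K ⊆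
      superlevel (1 / (4 * N)) γ f ∩ Metric.ball 0 R ×ˢ Metric.ball 0 R := by
  have hM' : (0 : ℝ) < M := by exact_mod_cast hM
  have hN : (1 : ℝ) ≤ N := by exact_mod_cast i₀.pos
  have hρ3 : ρ ≤ 1 := by
    have : (1 : ℝ) ≤ M := by exact_mod_cast hM
    nlinarith
  intro p hp
  simp only [cells, Set.mem_iUnion, Finset.mem_sigma, Finset.mem_range, exists_prop] at hp
  obtain ⟨⟨j, n⟩, ⟨hj, -⟩, hp⟩ := hp
  dsimp only at hp hj
  have hr : 0 < ρ ^ j := by positivity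
  have h1 := fst_coord_of_mem_cell hp
  have h2 := snd_coord_of_mem_cell hp
  have hnorm := norm_le_of_mem_cell (pow_le_one₀ hρ.le hρ3) (ladderPt_nonneg hρ j n)
    (ladderPt_add_le hρ hM hMρ j n) hp
  have hne : p.1 ≠ p.2 := fun h => by
    rw [h] at h1
    linarith [h1.2, h2.1]
  refine ⟨mem_superlevel_iff.2 ⟨hne, ?_⟩, ?_, ?_⟩
  · have hinc := ladder_increment hρ hM hMρ hj.le n h1.2 h2.1.le
    rw [hf _ hnorm.1, hf _ hnorm.2, abs_sub_comm]
    refine lt_of_lt_of_le ?_ (hinc.trans (le_abs_self _))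
    have e1 : (1 / M : ℝ) = ρ ^ (1 + γ) := by
      rw [div_eq_iff hM'.ne']; linarith
    have e2 : (1 / M : ℝ) ^ j = (ρ ^ j) ^ (1 + γ) := by
      rw [e1, ← Real.rpow_natCast, ← Real.rpow_natCast, ← Real.rpow_mul hρ.le,
        ← Real.rpow_mul hρ.le, mul_comm]
    have e3 : ‖p.1 - p.2‖ ^ (1 + γ) ≤ 3 * N * (ρ ^ j) ^ (1 + γ) := by
      calc ‖p.1 - p.2‖ ^ (1 + γ) ≤ (3 * N * ρ ^ j) ^ (1 + γ) :=
            Real.rpow_le_rpow (norm_nonneg _) (norm_sub_le_of_mem_cell hp) (by linarith)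
        _ = (3 * N : ℝ) ^ (1 + γ) * (ρ ^ j) ^ (1 + γ) := Real.mul_rpow (by positivity) hr.le
        -- Here `3N ≥ 1` and `1 + γ ≤ 1`. The constant `3N` is beaten by the level `1/(4N)`, with
        -- `4` in place of `3` to make the inequality strict.
        _ ≤ (3 * N : ℝ) ^ (1 : ℝ) * (ρ ^ j) ^ (1 + γ) := by
            gcongr
            · linarith
            · linarith
        _ = _ := by rw [Real.rpow_one]
    have e4 : 0 < (ρ ^ j) ^ (1 + γ) := by positivity
    rw [e2]
    calc 1 / (4 * N) * ‖p.1 - p.2‖ ^ (1 + γ) ≤ 1 / (4 * N) * (3 * N * (ρ ^ j) ^ (1 + γ)) := by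
          gcongr
      _ = 3 / 4 * (ρ ^ j) ^ (1 + γ) := by field_simp
      _ < _ := by linarith
  · simpa using lt_of_le_of_lt hnorm.1 hR
  · simpa using lt_of_le_of_lt hnorm.2 hR

end Cells

/-- Since `g' ≥ 0`, the term containing `g'` needs no absolute value, so it can be integrated by
parts afterwards. -/
theorem norm_fderiv_comp_coord_mul_le {N : ℕ} (i₀ : Fin N) {g : ℝ → ℝ} {χ : Eu N → ℝ}
    (hg : Differentiable ℝ g) (hmono : Monotone g) (hg0 : ∀ t, 0 ≤ g t) (hg1 : ∀ t, g t ≤ 1)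
    (hχ : Differentiable ℝ χ) (hχ0 : ∀ x, 0 ≤ χ x) (x : Eu N) :
    ‖fderiv ℝ (fun x : Eu N => g (x i₀) * χ x) x‖ ≤
      fderiv ℝ (fun x : Eu N => g (x i₀)) x (EuclideanSpace.single i₀ 1) * χ x + ‖fderiv ℝ χ x‖ := by
  have hG : HasFDerivAt (fun x : Eu N => g (x i₀)) (deriv g (x i₀) • EuclideanSpace.proj i₀) x :=
    ((hg (x i₀)).hasDerivAt.comp_hasFDerivAt x
      (EuclideanSpace.proj (𝕜 := ℝ) i₀ : Eu N →L[ℝ] ℝ).hasFDerivAt)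
  have hd : 0 ≤ deriv g (x i₀) := hmono.deriv_nonneg
  have hmul : HasFDerivAt (fun x : Eu N => g (x i₀) * χ x) _ x := hG.mul (hχ x).hasFDerivAt
  rw [hmul.fderiv, hG.fderiv]
  have hproj : ‖(EuclideanSpace.proj i₀ : Eu N →L[ℝ] ℝ)‖ ≤ 1 :=
    ContinuousLinearMap.opNorm_le_bound _ zero_le_one fun y => by
      simpa using PiLp.norm_apply_le y i₀
  have e : (deriv g (x i₀) • (EuclideanSpace.proj i₀ : Eu N →L[ℝ] ℝ)) (EuclideanSpace.single i₀ 1)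
      = deriv g (x i₀) := by simp
  rw [e]
  refine (norm_add_le _ _).trans ?_
  rw [norm_smul, norm_smul, norm_smul, Real.norm_of_nonneg (hg0 _), Real.norm_of_nonneg (hχ0 _),
    Real.norm_of_nonneg hd, add_comm]
  refine add_le_add ?_ (mul_le_of_le_one_left (norm_nonneg _) (hg1 _))
  rw [mul_comm]
  exact mul_le_mul_of_nonneg_right (mul_le_of_le_one_right hd hproj) (hχ0 _)

/-- Integration by parts gives `∫ g' χ = -∫ g ∂χ ≤ ∫ ‖∇χ‖`. The bound does not involve `g`, however
steep it is, and so holds uniformly in the depth of the ladder. -/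
theorem integral_norm_fderiv_comp_coord_mul_le {N : ℕ} (i₀ : Fin N) {g : ℝ → ℝ} {χ : Eu N → ℝ}
    (hg : ContDiff ℝ ∞ g) (hmono : Monotone g) (hg0 : ∀ t, 0 ≤ g t) (hg1 : ∀ t, g t ≤ 1)
    (hχ : ContDiff ℝ ∞ χ) (hχc : HasCompactSupport χ) (hχ0 : ∀ x, 0 ≤ χ x) :
    ∫ x, ‖fderiv ℝ (fun x : Eu N => g (x i₀) * χ x) x‖ ≤ 2 * ∫ x, ‖fderiv ℝ χ x‖ := by
  set e : Eu N := EuclideanSpace.single i₀ 1 with he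
  have hcoord : ContDiff ℝ ∞ fun x : Eu N => x i₀ :=
    (EuclideanSpace.proj (𝕜 := ℝ) i₀ : Eu N →L[ℝ] ℝ).contDiff
  have hG : ContDiff ℝ ∞ fun x : Eu N => g (x i₀) := hg.comp hcoord
  have hGd : Continuous fun x => fderiv ℝ (fun x : Eu N => g (x i₀)) x e :=
    (hG.continuous_fderiv (by simp)).clm_apply continuous_const
  have hχd : Continuous (fderiv ℝ χ) := hχ.continuous_fderiv (by simp)
  have hχde : Continuous fun x => fderiv ℝ χ x e := hχd.clm_apply continuous_const
  have i1 : Integrable fun x => fderiv ℝ (fun x : Eu N => g (x i₀)) x e * χ x :=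
    (hGd.mul hχ.continuous).integrable_of_hasCompactSupport hχc.mul_left
  have i2 : Integrable fun x : Eu N => g (x i₀) * fderiv ℝ χ x e :=
    (hG.continuous.mul hχde).integrable_of_hasCompactSupport (hχc.fderiv_apply (𝕜 := ℝ) e).mul_left
  have i3 : Integrable fun x : Eu N => g (x i₀) * χ x :=
    (hG.continuous.mul hχ.continuous).integrable_of_hasCompactSupport hχc.mul_left
  have i4 : Integrable fun x : Eu N => ‖fderiv ℝ χ x‖ :=
    hχd.norm.integrable_of_hasCompactSupport (hχc.fderiv (𝕜 := ℝ)).norm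
  have hparts := integral_mul_fderiv_eq_neg_fderiv_mul_of_integrable i1 i2 i3
    (fun x _ => hG.differentiable (by simp) x) (fun x _ => hχ.differentiable (by simp) x)
  have hb : ∫ x, fderiv ℝ (fun x : Eu N => g (x i₀)) x e * χ x ≤ ∫ x, ‖fderiv ℝ χ x‖ := by
    rw [← neg_eq_iff_eq_neg.2 hparts, ← integral_neg]
    refine integral_mono i2.neg i4 fun x => ?_
    refine (neg_le_abs _).trans ?_
    rw [abs_mul, abs_of_nonneg (hg0 _)]
    refine (mul_le_of_le_one_left (abs_nonneg _) (hg1 _)).trans ?_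
    simpa [he] using (fderiv ℝ χ x).le_opNorm e
  calc ∫ x, ‖fderiv ℝ (fun x : Eu N => g (x i₀) * χ x) x‖
      ≤ ∫ x, (fderiv ℝ (fun x : Eu N => g (x i₀)) x e * χ x + ‖fderiv ℝ χ x‖) :=
        integral_mono_of_nonneg (Eventually.of_forall fun _ => norm_nonneg _) (i1.add i4)
          (Eventually.of_forall fun x => norm_fderiv_comp_coord_mul_le i₀
            (hg.differentiable (by simp)) hmono hg0 hg1 (hχ.differentiable (by simp)) hχ0 x)
    _ = _ := integral_add i1 i4
    _ ≤ _ := by linarith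

/-- There are bumps of bounded `W^{1,1}` norm, with a common support and a common sup bound, whose
superlevel set at a fixed height has arbitrarily large measure. -/
theorem exists_bump {N : ℕ} (hN : 1 ≤ N) {γ : ℝ} (hγ : -1 ≤ γ) (hγ0 : γ < 0) :
    ∃ R C t : ℝ, 1 ≤ R ∧ 0 < t ∧ ∀ K : ℝ, ∃ f : Eu N → ℝ, ContDiff ℝ ∞ f ∧
      tsupport f ⊆ Metric.ball 0 R ∧ (∀ x, |f x| ≤ 1) ∧ ∫ x, ‖fderiv ℝ f x‖ ≤ C ∧
      ENNReal.ofReal K ≤ nu N γ (superlevel t γ f ∩ Metric.ball 0 R ×ˢ Metric.ball 0 R) := by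
  have hN' : (1 : ℝ) ≤ N := by exact_mod_cast hN
  let i₀ : Fin N := ⟨0, hN⟩
  -- Both points of every pair in `cells` have norm at most `2N`, so the cutoff equals `1` there.
  let χ : ContDiffBump (0 : Eu N) := ⟨2 * N, 2 * N + 1, by positivity, by linarith⟩
  obtain ⟨M, ρ, hM, hρ, hMρ, hdim⟩ := exists_ladder_parameters (s := 1 + γ) (by linarith)
    (by linarith)
  refine ⟨2 * N + 2, 2 * ∫ x, ‖fderiv ℝ χ x‖, 1 / (4 * N), by linarith, by positivity, fun K => ?_⟩
  have hc : (0 : ℝ) < (3 * N : ℝ) ^ (γ - N) := by positivity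
  obtain ⟨k, hk⟩ := exists_nat_ge (K / (3 * N : ℝ) ^ (γ - N))
  rw [div_le_iff₀ hc] at hk
  have hg := ladder_contDiff M ρ k
  have hg0 := ladder_nonneg (M := M) hρ k
  have hg1 := ladder_le_one hρ hM hMρ.le k
  have hcoord : ContDiff ℝ ∞ fun x : Eu N => x i₀ :=
    (EuclideanSpace.proj (𝕜 := ℝ) i₀ : Eu N →L[ℝ] ℝ).contDiff
  refine ⟨fun x => ladder M ρ k (x i₀) * χ x, (hg.comp hcoord).mul χ.contDiff, ?_, fun x => ?_,
    integral_norm_fderiv_comp_coord_mul_le i₀ hg (ladder_monotone hρ k) hg0 hg1 χ.contDiff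
      χ.hasCompactSupport (fun x => χ.nonneg), ?_⟩
  · refine (tsupport_mul_subset_right).trans ?_
    rw [χ.tsupport_eq]
    exact Metric.closedBall_subset_ball (by simp only [χ]; linarith)
  · rw [abs_of_nonneg (mul_nonneg (hg0 _) χ.nonneg)]
    exact mul_le_one₀ (hg1 _) χ.nonneg χ.le_one
  · refine (ENNReal.ofReal_le_ofReal hk).trans ((nu_cells_ge (i₀ := i₀) (by linarith) hρ hM hMρ.le
      hdim k).trans (measure_mono ?_))
    refine cells_subset_superlevel hγ hγ0 hρ hM hMρ.le hdim k (fun x hx => ?_) (by linarith)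
    rw [χ.one_of_mem_closedBall (by simpa [χ] using hx), mul_one]

/-! ### Scaling -/

theorem measurableSet_superlevel {N : ℕ} {lam b : ℝ} {u : Eu N → ℝ} (hu : Measurable u) :
    MeasurableSet (superlevel lam b u) := by
  have e : superlevel lam b u = {p | p.1 = p.2}ᶜ ∩
      {p | lam * ‖p.1 - p.2‖ ^ (1 + b) < |u p.1 - u p.2|} := by
    ext p; exact mem_superlevel_iff
  rw [e]
  refine (measurableSet_eq_fun measurable_fst measurable_snd).compl.inter (measurableSet_lt ?_ ?_)
  · fun_prop
  · exact ((hu.comp measurable_fst).sub (hu.comp measurable_snd)).abs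

theorem map_rescale_volume {N : ℕ} {r : ℝ} (hr : 0 < r) (z : Eu N) :
    Measure.map (fun p : Eu N × Eu N => (r⁻¹ • (p.1 - z), r⁻¹ • (p.2 - z))) volume =
      ENNReal.ofReal (r ^ (2 * N)) • volume := by
  have e : (fun p : Eu N × Eu N => (r⁻¹ • (p.1 - z), r⁻¹ • (p.2 - z))) =
      (fun p => r⁻¹ • p) ∘ fun p => p - (z, z) := by
    ext p <;> simp
  have : (volume : Measure (Eu N × Eu N)).IsAddHaarMeasure :=
    inferInstanceAs ((volume : Measure (Eu N)).prod (volume : Measure (Eu N))).IsAddHaarMeasure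
  have hsub : Measure.map (fun p : Eu N × Eu N => p - (z, z)) volume = volume :=
    (measurePreserving_sub_right (volume : Measure (Eu N × Eu N)) (z, z)).map_eq
  have hsmul : Measure.map (fun p : Eu N × Eu N => r⁻¹ • p) volume = _ :=
    Measure.map_addHaar_smul volume (inv_ne_zero hr.ne')
  rw [e, ← Measure.map_map (measurable_const_smul _) (by fun_prop),
    hsub, hsmul]
  congr 2
  rw [Module.finrank_prod, finrank_euclideanSpace_fin, ← two_mul, inv_pow, inv_inv,
    abs_of_pos (by positivity)]

/-- Homogeneity: the volume contributes `r^(2N)` and the density `r^(γ-N)`. -/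
theorem nu_preimage_rescale {N : ℕ} (γ : ℝ) {r : ℝ} (hr : 0 < r) (z : Eu N)
    {S : Set (Eu N × Eu N)} (hS : MeasurableSet S) :
    nu N γ ((fun p : Eu N × Eu N => (r⁻¹ • (p.1 - z), r⁻¹ • (p.2 - z))) ⁻¹' S) =
      ENNReal.ofReal (r ^ (N + γ)) * nu N γ S := by
  set T := fun p : Eu N × Eu N => (r⁻¹ • (p.1 - z), r⁻¹ • (p.2 - z)) with hT
  have hTm : Measurable T := by rw [hT]; fun_prop
  have hD : MeasurableSet {p : Eu N × Eu N | p.1 ≠ p.2} :=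
    (measurableSet_eq_fun measurable_fst measurable_snd).compl
  have hpre : T ⁻¹' S ∩ {p : Eu N × Eu N | p.1 ≠ p.2} = T ⁻¹' (S ∩ {p | p.1 ≠ p.2}) := by
    ext p
    simp [hT, hr.ne']
  have hk : ∀ p : Eu N × Eu N, ENNReal.ofReal (‖p.1 - p.2‖ ^ (γ - N)) =
      ENNReal.ofReal (r ^ (γ - N)) * ENNReal.ofReal (‖(T p).1 - (T p).2‖ ^ (γ - N)) := by
    intro p
    rw [← ENNReal.ofReal_mul (by positivity), ← Real.mul_rpow hr.le (norm_nonneg _)]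
    congr 2
    rw [hT]
    dsimp only
    rw [← smul_sub, sub_sub_sub_cancel_right, norm_smul, Real.norm_of_nonneg (by positivity),
      mul_inv_cancel_left₀ hr.ne']
  have hmeas : Measurable fun p : Eu N × Eu N => ENNReal.ofReal (‖p.1 - p.2‖ ^ (γ - N)) := by
    fun_prop
  rw [nu, withDensity_apply _ (hTm hS), withDensity_apply _ hS, Measure.restrict_restrict (hTm hS),
    Measure.restrict_restrict hS, hpre]
  rw [lintegral_congr hk, lintegral_const_mul' _ _ ENNReal.ofReal_ne_top,
    ← setLIntegral_map (hS.inter hD) hmeas hTm, map_rescale_volume hr z, Measure.restrict_smul,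
    lintegral_smul_measure, smul_eq_mul, ← mul_assoc, ← ENNReal.ofReal_mul (by positivity)]
  congr 2
  rw [← Real.rpow_natCast, ← Real.rpow_add hr]
  congr 1
  push_cast
  ring

/-- The rescaled bump `A f((x - z) / r)`. -/
def rescale {N : ℕ} (A r : ℝ) (z : Eu N) (f : Eu N → ℝ) (x : Eu N) : ℝ := A * f (r⁻¹ • (x - z))

section Rescale

variable {N : ℕ} {A r : ℝ} {z : Eu N} {f : Eu N → ℝ}

theorem contDiff_rescale (hf : ContDiff ℝ ∞ f) : ContDiff ℝ ∞ (rescale A r z f) :=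
  contDiff_const.mul (hf.comp ((contDiff_id.sub contDiff_const).const_smul r⁻¹))

theorem mem_ball_rescale_iff (hr : 0 < r) {R : ℝ} {x : Eu N} :
    r⁻¹ • (x - z) ∈ Metric.ball 0 R ↔ x ∈ Metric.ball z (R * r) := by
  rw [mem_ball_zero_iff, mem_ball_iff_norm, norm_smul, Real.norm_of_nonneg (by positivity),
    inv_mul_lt_iff₀ hr, mul_comm]

theorem tsupport_rescale_subset (hr : 0 < r) {R : ℝ} (hf : tsupport f ⊆ Metric.ball 0 R) :
    tsupport (rescale A r z f) ⊆ Metric.ball z (R * r) := by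
  have h1 : tsupport (rescale A r z f) ⊆ (fun x => r⁻¹ • (x - z)) ⁻¹' tsupport f := by
    refine closure_minimal (fun x hx => subset_tsupport f fun h => hx ?_)
      ((isClosed_tsupport f).preimage (by fun_prop))
    rw [rescale, h, mul_zero]
  exact fun x hx => (mem_ball_rescale_iff hr).1 (hf (h1 hx))

theorem integral_comp_rescale {N : ℕ} {r : ℝ} (hr : 0 < r) (z : Eu N) (F : Eu N → ℝ) :
    ∫ x, F (r⁻¹ • (x - z)) = r ^ N * ∫ x, F x := by
  rw [integral_sub_right_eq_self (fun x => F (r⁻¹ • x)) z,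
    Measure.integral_comp_inv_smul_of_nonneg _ _ hr.le, finrank_euclideanSpace_fin, smul_eq_mul]

theorem norm_fderiv_rescale (hr : 0 < r) (hA : 0 < A) (hf : Differentiable ℝ f) (x : Eu N) :
    ‖fderiv ℝ (rescale A r z f) x‖ = A * r⁻¹ * ‖fderiv ℝ f (r⁻¹ • (x - z))‖ := by
  have h1 : HasFDerivAt (fun x : Eu N => r⁻¹ • (x - z)) (r⁻¹ • ContinuousLinearMap.id ℝ (Eu N)) x :=
    ((hasFDerivAt_id x).sub_const z).const_smul r⁻¹
  have h2 : HasFDerivAt (rescale A r z f) _ x := ((hf _).hasFDerivAt.comp x h1).const_mul A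
  rw [h2.fderiv, ContinuousLinearMap.comp_smul, ContinuousLinearMap.comp_id, norm_smul, norm_smul,
    Real.norm_of_nonneg hA.le, Real.norm_of_nonneg (by positivity), mul_assoc]

theorem integral_norm_fderiv_rescale (hN : 1 ≤ N) (hr : 0 < r) (hA : 0 < A)
    (hf : Differentiable ℝ f) :
    ∫ x, ‖fderiv ℝ (rescale A r z f) x‖ = A * r ^ (N - 1) * ∫ x, ‖fderiv ℝ f x‖ := by
  simp_rw [norm_fderiv_rescale hr hA hf]
  rw [integral_const_mul, integral_comp_rescale hr z fun x => ‖fderiv ℝ f x‖]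
  obtain ⟨n, rfl⟩ : ∃ n, N = n + 1 := ⟨N - 1, by omega⟩
  rw [Nat.add_sub_cancel, pow_succ]
  field_simp

theorem integral_norm_rescale (hr : 0 < r) (hA : 0 < A) :
    ∫ x, ‖rescale A r z f x‖ = A * r ^ N * ∫ x, ‖f x‖ := by
  simp_rw [rescale, norm_mul, Real.norm_of_nonneg hA.le]
  rw [integral_const_mul, integral_comp_rescale hr z fun x => ‖f x‖, mul_assoc]

/-- Only pairs inside one ball are counted, so `u` need agree with the bump only there and the other
summands of a superposition cannot interfere. -/
theorem ofReal_mul_nu_le_nu_superlevel {γ t lam R : ℝ} (hr : 0 < r) (hA : 0 < A)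
    (hf : Measurable f) {u : Eu N → ℝ}
    (hu : ∀ x ∈ Metric.ball z (R * r), u x = rescale A r z f x)
    (hlam : lam * r ^ (1 + γ) ≤ t * A) :
    ENNReal.ofReal (r ^ (N + γ)) *
        nu N γ (superlevel t γ f ∩ Metric.ball 0 R ×ˢ Metric.ball 0 R) ≤
      nu N γ (superlevel lam γ u) := by
  rw [← nu_preimage_rescale γ hr z ((measurableSet_superlevel hf).inter
    (measurableSet_ball.prod measurableSet_ball))]
  refine measure_mono ?_
  rintro ⟨x, y⟩ ⟨h1, h2, h3⟩
  obtain ⟨hne, h1⟩ := mem_superlevel_iff.1 h1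
  dsimp only at hne h1 h2 h3
  refine mem_superlevel_iff.2 ⟨fun h => hne (by dsimp only at h; rw [h]), ?_⟩
  dsimp only
  rw [hu x ((mem_ball_rescale_iff hr).1 h2), hu y ((mem_ball_rescale_iff hr).1 h3), rescale,
    rescale, ← mul_sub, abs_mul, abs_of_pos hA]
  have hnorm : ‖x - y‖ = r * ‖r⁻¹ • (x - z) - r⁻¹ • (y - z)‖ := by
    rw [← smul_sub, sub_sub_sub_cancel_right, norm_smul, Real.norm_of_nonneg (by positivity),
      mul_inv_cancel_left₀ hr.ne']
  rw [hnorm, Real.mul_rpow hr.le (norm_nonneg _), ← mul_assoc]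
  calc _ ≤ t * A * ‖r⁻¹ • (x - z) - r⁻¹ • (y - z)‖ ^ (1 + γ) := by gcongr
    _ = A * (t * ‖r⁻¹ • (x - z) - r⁻¹ • (y - z)‖ ^ (1 + γ)) := by ring
    _ < _ := by gcongr

end Rescale

/-! ### Superpositions of bumps with disjoint supports -/

theorem integrable_tsum_of_disjoint {N : ℕ} {F : Type*} [NormedAddCommGroup F] [CompleteSpace F]
    {b : ℕ → Eu N → F}
    (hb : ∀ n, Integrable (b n)) (hs : Summable fun n => ∫ x, ‖b n x‖)
    (hd : ∀ x, ∃ n, ∀ m, m ≠ n → b m x = 0) : Integrable fun x => ∑' n, b n x := by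
  refine ⟨?_, ?_⟩
  · refine aestronglyMeasurable_of_tendsto_ae (u := atTop)
      (f := fun n x => ∑ i ∈ Finset.range n, b i x) (fun n => ?_) (Eventually.of_forall fun x => ?_)
    · exact Finset.aestronglyMeasurable_fun_sum _ fun i _ => (hb i).1
    · obtain ⟨n, hn⟩ := hd x
      exact (hasSum_single n hn).summable.hasSum.tendsto_sum_nat
  · have h1 : ∀ n, ∫⁻ x, ‖b n x‖ₑ = ENNReal.ofReal (∫ x, ‖b n x‖) := fun n =>
      (ofReal_integral_norm_eq_lintegral_enorm (hb n)).symm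
    calc ∫⁻ x, ‖∑' n, b n x‖ₑ ≤ ∫⁻ x, ∑' n, ‖b n x‖ₑ :=
          lintegral_mono fun x => enorm_tsum_le_tsum_enorm
      _ = ∑' n, ∫⁻ x, ‖b n x‖ₑ := lintegral_tsum fun n => (hb n).1.enorm
      _ = ∑' n, ENNReal.ofReal (∫ x, ‖b n x‖) := by simp_rw [h1]
      _ < ⊤ := by
          rw [← ENNReal.ofReal_tsum_of_nonneg (fun n => integral_nonneg fun _ => norm_nonneg _) hs]
          exact ENNReal.ofReal_lt_top

theorem hasWeakGradient_of_contDiff {N : ℕ} {u : Eu N → ℝ} (hu : ContDiff ℝ ∞ u) :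
    HasWeakGradient u (gradient u) := by
  intro φ hφ hc v
  have hin : ∀ x, inner ℝ (gradient u x) v = fderiv ℝ u x v := fun x => by
    rw [← toDual_gradient, InnerProductSpace.toDual_apply_apply]
  have hud : Continuous fun x => fderiv ℝ u x v :=
    (hu.continuous_fderiv (by simp)).clm_apply continuous_const
  simp_rw [hin, mul_comm (φ _)]
  refine integral_mul_fderiv_eq_neg_fderiv_mul_of_integrable ?_ ?_ ?_
    (fun x _ => hu.differentiable (by simp) x) (fun x _ => hφ.differentiable (by simp) x)
  · exact (hud.mul hφ.continuous).integrable_of_hasCompactSupport hc.mul_left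
  · exact integrable_mul_fderiv hu.continuous.locallyIntegrable hφ hc v
  · exact (hu.continuous.mul hφ.continuous).integrable_of_hasCompactSupport hc.mul_left

theorem norm_gradient {N : ℕ} (u : Eu N → ℝ) (x : Eu N) : ‖gradient u x‖ = ‖fderiv ℝ u x‖ := by
  rw [gradient, LinearIsometryEquiv.norm_map]

/-- A test function and its derivatives are bounded, so the defining identity can be summed term by
term. Disjointness of the gradients makes their pointwise series a finite sum, which commutes with
the inner product. -/
theorem hasWeakGradient_tsum {N : ℕ} {b : ℕ → Eu N → ℝ} {g : ℕ → Eu N → Eu N}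
    (hb : ∀ n, Integrable (b n)) (hg : ∀ n, Integrable (g n))
    (hw : ∀ n, HasWeakGradient (b n) (g n))
    (hbs : Summable fun n => ∫ x, ‖b n x‖) (hgs : Summable fun n => ∫ x, ‖g n x‖)
    (hgd : ∀ x, ∃ n, ∀ m, m ≠ n → g m x = 0) :
    HasWeakGradient (fun x => ∑' n, b n x) (fun x => ∑' n, g n x) := by
  intro φ hφ hc v
  have hφd : Continuous fun x => fderiv ℝ φ x v :=
    (hφ.continuous_fderiv (by simp)).clm_apply continuous_const
  obtain ⟨C, hC⟩ := (hc.fderiv_apply (𝕜 := ℝ) v).exists_bound_of_continuous hφd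
  obtain ⟨D, hD⟩ := hc.exists_bound_of_continuous hφ.continuous
  have s1 : Summable fun n => ∫ x, ‖b n x * fderiv ℝ φ x v‖ := by
    refine (hbs.mul_right C).of_nonneg_of_le (fun n => integral_nonneg fun _ => norm_nonneg _)
      fun n => ?_
    rw [← integral_mul_const]
    refine integral_mono (integrable_mul_fderiv (hb n).locallyIntegrable hφ hc v).norm
      ((hb n).norm.mul_const C) fun x => ?_
    rw [norm_mul]
    exact mul_le_mul_of_nonneg_left (hC x) (norm_nonneg _)
  have s2 : Summable fun n => ∫ x, ‖φ x * inner ℝ (g n x) v‖ := by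
    refine (hgs.mul_right (D * ‖v‖)).of_nonneg_of_le
      (fun n => integral_nonneg fun _ => norm_nonneg _) fun n => ?_
    rw [← integral_mul_const]
    refine integral_mono (integrable_mul_inner (hg n) hφ hc v).norm
      ((hg n).norm.mul_const _) fun x => ?_
    rw [norm_mul]
    calc ‖φ x‖ * ‖inner ℝ (g n x) v‖ ≤ D * (‖g n x‖ * ‖v‖) :=
          mul_le_mul (hD x) (norm_inner_le_norm _ _) (norm_nonneg _) ((norm_nonneg _).trans (hD x))
      _ = _ := by ring
  have h1 := (hasSum_integral_of_summable_integral_norm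
    (fun n => integrable_mul_fderiv (hb n).locallyIntegrable hφ hc v) s1).tsum_eq
  have h2 := (hasSum_integral_of_summable_integral_norm
    (fun n => integrable_mul_inner (hg n) hφ hc v) s2).tsum_eq
  have e1 : ∀ x, ∑' n, b n x * fderiv ℝ φ x v = (∑' n, b n x) * fderiv ℝ φ x v :=
    fun x => tsum_mul_right
  have e2 : ∀ x, ∑' n, φ x * inner ℝ (g n x) v = φ x * inner ℝ (∑' n, g n x) v := by
    intro x
    obtain ⟨n, hn⟩ := hgd x
    rw [tsum_eq_single n hn, tsum_eq_single n fun m hm => by rw [hn m hm]; simp]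
  simp_rw [e1] at h1
  simp_rw [e2] at h2
  rw [← h1, ← h2, ← tsum_neg]
  exact tsum_congr fun n => hw n φ hφ hc v

theorem memW11_tsum {N : ℕ} {b : ℕ → Eu N → ℝ} (hb : ∀ n, ContDiff ℝ ∞ (b n))
    (hc : ∀ n, HasCompactSupport (b n)) (hd : ∀ x, ∃ n, ∀ m, m ≠ n → x ∉ tsupport (b m))
    (hbs : Summable fun n => ∫ x, ‖b n x‖) (hgs : Summable fun n => ∫ x, ‖fderiv ℝ (b n) x‖) :
    MemW11 fun x => ∑' n, b n x := by
  have hbi : ∀ n, Integrable (b n) := fun n =>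
    (hb n).continuous.integrable_of_hasCompactSupport (hc n)
  have hgi : ∀ n, Integrable (gradient (b n)) := fun n => by
    have hi := ((hb n).continuous_fderiv (by simp)).integrable_of_hasCompactSupport
      (μ := volume) ((hc n).fderiv (𝕜 := ℝ))
    exact (InnerProductSpace.toDual ℝ (Eu N)).symm.toContinuousLinearEquiv
      |>.toContinuousLinearMap.integrable_comp hi
  have hbd : ∀ x, ∃ n, ∀ m, m ≠ n → b m x = 0 := fun x => by
    obtain ⟨n, hn⟩ := hd x
    exact ⟨n, fun m hm => image_eq_zero_of_notMem_tsupport (hn m hm)⟩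
  have hgd : ∀ x, ∃ n, ∀ m, m ≠ n → gradient (b m) x = 0 := fun x => by
    obtain ⟨n, hn⟩ := hd x
    refine ⟨n, fun m hm => ?_⟩
    rw [gradient, fderiv_of_notMem_tsupport ℝ (hn m hm), map_zero]
  have hgs' : Summable fun n => ∫ x, ‖gradient (b n) x‖ := by simpa only [norm_gradient] using hgs
  have hi := integrable_tsum_of_disjoint hbi hbs hbd
  exact ⟨⟨hi.locallyIntegrable, _, integrable_tsum_of_disjoint hgi hgs' hgd,
    hasWeakGradient_tsum hbi hgi (fun n => hasWeakGradient_of_contDiff (hb n)) hbs hgs' hgd⟩, hi⟩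

theorem exists_forall_notMem_of_disjoint {α : Type*} {s : ℕ → Set α}
    (h : Pairwise fun n m => Disjoint (s n) (s m)) (x : α) : ∃ n, ∀ m, m ≠ n → x ∉ s m := by
  by_cases hx : ∃ n, x ∈ s n
  · obtain ⟨n, hn⟩ := hx
    exact ⟨n, fun m hm hxm => Set.disjoint_left.1 (h hm) hxm hn⟩
  · push Not at hx
    exact ⟨0, fun m _ => hx m⟩

/-- Superpositions of rescaled bumps in prescribed disjoint balls, with prescribed amplitudes `A n`
and arbitrarily large superlevel sets below the heights `t A n / r n ^ (1 + γ)`. -/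
theorem exists_superposition {N : ℕ} (hN : 1 ≤ N) {γ : ℝ} (hγ : -1 ≤ γ) (hγ0 : γ < 0) :
    ∃ R t : ℝ, 1 ≤ R ∧ 0 < t ∧ ∀ (A r K : ℕ → ℝ) (z : ℕ → Eu N), (∀ n, 0 < A n) → (∀ n, 0 < r n) →
      (∀ n, r n ≤ 1) →
      (Pairwise fun n m => Disjoint (Metric.ball (z n) (R * r n)) (Metric.ball (z m) (R * r m))) →
      (Summable fun n => A n * r n ^ (N - 1)) →
      ∃ b : ℕ → Eu N → ℝ, (∀ n, ContDiff ℝ ∞ (b n)) ∧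
        (∀ n, tsupport (b n) ⊆ Metric.ball (z n) (R * r n)) ∧ (∀ n x, |b n x| ≤ A n) ∧
        MemW11 (fun x => ∑' n, b n x) ∧
        ∀ n lam, lam * r n ^ (1 + γ) ≤ t * A n →
          ENNReal.ofReal (K n) ≤ nu N γ (superlevel lam γ fun x => ∑' n, b n x) := by
  obtain ⟨R, C, t, hR, ht, hbump⟩ := exists_bump hN hγ hγ0
  refine ⟨R, t, hR, ht, fun A r K z hA hr hr1 hd hs => ?_⟩
  -- Asking for this much measure before rescaling cancels the factor `r^(N+γ)`, at no cost in norm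
  -- because `C` does not depend on the depth.
  choose f hf hfs hf1 hfC hfK using fun n => hbump (K n / r n ^ (N + γ))
  have hts : ∀ n, tsupport (rescale (A n) (r n) (z n) (f n)) ⊆ Metric.ball (z n) (R * r n) :=
    fun n => tsupport_rescale_subset (hr n) (hfs n)
  have hcs : ∀ n, HasCompactSupport (rescale (A n) (r n) (z n) (f n)) := fun n =>
    HasCompactSupport.of_support_subset_isCompact (isCompact_closedBall (z n) (R * r n))
      ((subset_tsupport _).trans ((hts n).trans Metric.ball_subset_closedBall))
  have hdx : ∀ x, ∃ n, ∀ m, m ≠ n → x ∉ tsupport (rescale (A m) (r m) (z m) (f m)) := fun x => by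
    obtain ⟨n, hn⟩ := exists_forall_notMem_of_disjoint hd x
    exact ⟨n, fun m hm h => hn m hm (hts m h)⟩
  have hf0 : ∀ n, ∫ x, ‖f n x‖ ≤ volume.real (Metric.ball (0 : Eu N) R) := by
    intro n
    have h1 : ∫ x, ‖f n x‖ = ∫ x in Metric.ball (0 : Eu N) R, ‖f n x‖ :=
      (setIntegral_eq_integral_of_forall_compl_eq_zero fun x hx => by
        rw [image_eq_zero_of_notMem_tsupport fun h => hx (hfs n h), norm_zero]).symm
    have h2 : ‖∫ x in Metric.ball (0 : Eu N) R, ‖f n x‖‖ ≤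
        1 * volume.real (Metric.ball (0 : Eu N) R) :=
      norm_setIntegral_le_of_norm_le_const measure_ball_lt_top fun x _ => by simpa using hf1 n x
    rw [h1]
    exact (le_abs_self _).trans (h2.trans (one_mul _).le)
  refine ⟨fun n => rescale (A n) (r n) (z n) (f n), fun n => contDiff_rescale (hf n), hts, ?_, ?_, ?_⟩
  · intro n x
    dsimp only [rescale]
    rw [abs_mul, abs_of_pos (hA n)]
    exact mul_le_of_le_one_right (hA n).le (hf1 n _)
  · refine memW11_tsum (fun n => contDiff_rescale (hf n)) hcs hdx ?_ ?_
    · refine (hs.mul_right (volume.real (Metric.ball (0 : Eu N) R))).of_nonneg_of_le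
        (fun n => integral_nonneg fun _ => norm_nonneg _) fun n => ?_
      rw [integral_norm_rescale (hr n) (hA n)]
      have := (hA n).le
      have := (hr n).le
      have h2 : r n ^ N ≤ r n ^ (N - 1) := pow_le_pow_of_le_one this (hr1 n) (by omega)
      exact mul_le_mul (by gcongr) (hf0 n) (integral_nonneg fun _ => norm_nonneg _) (by positivity)
    · refine (hs.mul_right C).of_nonneg_of_le
        (fun n => integral_nonneg fun _ => norm_nonneg _) fun n => ?_
      rw [integral_norm_fderiv_rescale hN (hr n) (hA n) ((hf n).differentiable (by simp))]
      have := (hA n).le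
      have := (hr n).le
      exact mul_le_mul_of_nonneg_left (hfC n) (by positivity)
  · intro n lam hlam
    have hrp : 0 < r n ^ (N + γ) := Real.rpow_pos_of_pos (hr n) _
    refine le_trans ?_ (ofReal_mul_nu_le_nu_superlevel (z := z n) (R := R) (hr n) (hA n)
      (hf n).continuous.measurable (u := fun x => ∑' n, rescale (A n) (r n) (z n) (f n) x) (fun x hx => ?_) hlam)
    · calc ENNReal.ofReal (K n)
          = ENNReal.ofReal (r n ^ (N + γ)) * ENNReal.ofReal (K n / r n ^ (N + γ)) := by
            rw [← ENNReal.ofReal_mul hrp.le, mul_div_cancel₀ _ hrp.ne']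
        _ ≤ _ := by gcongr; exact hfK n
    · refine tsum_eq_single n fun m hm => image_eq_zero_of_notMem_tsupport fun h => ?_
      exact Set.disjoint_left.1 (hd hm) (hts m h) hx

/-! ### Existence of the counterexamples -/

/-- For `t 2^(-n-1) < lam ≤ t 2^(-n)` the assumed measure `n 2^(n+1) / t` makes the product at least
`n`, so a dyadic sequence of bumps controls all small `lam`. -/
theorem tendsto_levelFunctional_top {N : ℕ} {γ t : ℝ} (ht : 0 < t) {u : Eu N → ℝ}
    (h : ∀ (n : ℕ) (lam : ℝ), lam ≤ t * (1 / 2) ^ n →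
      ENNReal.ofReal (n * 2 ^ (n + 1) / t) ≤ nu N γ (superlevel lam γ u)) :
    Tendsto (levelFunctional γ u) (𝓝[>] 0) (𝓝 ⊤) := by
  refine ENNReal.tendsto_nhds_top fun n₀ => ?_
  have hpos : 0 < t * (1 / 2) ^ (n₀ + 1) := by positivity
  filter_upwards [Ioo_mem_nhdsGT hpos] with lam hlam
  have h1 : lam / t < (1 / 2) ^ (n₀ + 1) := by rw [div_lt_iff₀ ht]; linarith [hlam.2]
  obtain ⟨n, hn1, hn2⟩ := exists_nat_pow_near_of_lt_one (x := lam / t) (y := 1 / 2)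
    (div_pos hlam.1 ht) (h1.le.trans (pow_le_one₀ (by norm_num) (by norm_num))) (by norm_num)
    (by norm_num)
  have hn : n₀ < n := by
    have := (pow_lt_pow_iff_right_of_lt_one₀ (show (0 : ℝ) < 1 / 2 by norm_num)
      (by norm_num)).1 (hn1.trans h1)
    omega
  rw [div_le_iff₀ ht] at hn2
  rw [lt_div_iff₀ ht] at hn1
  calc (n₀ : ℝ≥0∞) < n := by exact_mod_cast hn
    _ = ENNReal.ofReal n := (ENNReal.ofReal_natCast n).symm
    _ ≤ ENNReal.ofReal (lam * (n * 2 ^ (n + 1) / t)) := by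
        refine ENNReal.ofReal_le_ofReal ?_
        have e : (n : ℝ) = (1 / 2) ^ (n + 1) * t * (n * 2 ^ (n + 1) / t) := by
          rw [one_div, inv_pow]; field_simp
        calc (n : ℝ) = (1 / 2) ^ (n + 1) * t * (n * 2 ^ (n + 1) / t) := e
          _ ≤ _ := by gcongr
    _ = ENNReal.ofReal lam * ENNReal.ofReal (n * 2 ^ (n + 1) / t) := ENNReal.ofReal_mul hlam.1.le
    _ ≤ levelFunctional γ u lam := by
        rw [levelFunctional]
        gcongr
        exact h n lam (by linarith)

theorem contDiff_tsum_of_finite_on_balls {N : ℕ} {b : ℕ → Eu N → ℝ}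
    (hb : ∀ n, ContDiff ℝ ∞ (b n))
    (h : ∀ ρ : ℝ, ∃ n₀, ∀ n, n₀ ≤ n → ∀ x, ‖x‖ < ρ → b n x = 0) :
    ContDiff ℝ ∞ fun x => ∑' n, b n x := by
  refine contDiff_iff_contDiffAt.2 fun x => ?_
  obtain ⟨n₀, hn₀⟩ := h (‖x‖ + 1)
  have hfin : ContDiff ℝ ∞ fun y => ∑ n ∈ Finset.range n₀, b n y := ContDiff.sum fun n _ => hb n
  refine hfin.contDiffAt.congr_of_eventuallyEq ?_
  have hev : ∀ᶠ y : Eu N in 𝓝 x, ‖y‖ < ‖x‖ + 1 :=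
    continuous_norm.continuousAt.eventually_lt continuousAt_const (by linarith)
  filter_upwards [hev] with y hy
  exact tsum_eq_sum fun n hn => hn₀ n (by simpa using hn) y hy

theorem exists_smooth_counterexample {N : ℕ} (hN : 1 ≤ N) {γ : ℝ} (hγ : -1 ≤ γ) (hγ0 : γ < 0) :
    ∃ u : Eu N → ℝ, ContDiff ℝ ∞ u ∧ MemHomW11 u ∧ RapidlyDecreasing u ∧
      Tendsto (levelFunctional γ u) (𝓝[>] 0) (𝓝 ⊤) := by
  obtain ⟨R, t, hR, ht, H⟩ := exists_superposition hN hγ hγ0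
  let e : Eu N := EuclideanSpace.single ⟨0, hN⟩ 1
  have he : ‖e‖ = 1 := by simp [e]
  let z : ℕ → Eu N := fun n => (2 * R * n) • e
  have hz : ∀ n, ‖z n‖ = 2 * R * n := fun n => by
    rw [norm_smul, he, mul_one, Real.norm_of_nonneg (by positivity)]
  have hd : Pairwise fun n m =>
      Disjoint (Metric.ball (z n) (R * 1))
        (Metric.ball (z m) (R * 1)) := by
    intro n m hnm
    refine Metric.ball_disjoint_ball ?_
    have h1 : (1 : ℝ) ≤ |(n : ℝ) - m| := by
      have : (1 : ℤ) ≤ |(n : ℤ) - m| := Int.one_le_abs (sub_ne_zero.2 (by exact_mod_cast hnm))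
      exact_mod_cast this
    rw [dist_eq_norm, ← sub_smul, norm_smul, he, mul_one, ← mul_sub, norm_mul,
      Real.norm_of_nonneg (by positivity), Real.norm_eq_abs]
    nlinarith
  obtain ⟨b, hb, hbs, hbA, hmem, hlev⟩ := H (fun n => (1 / 2) ^ n) (fun _ => 1)
    (fun n => n * 2 ^ (n + 1) / t) z (fun n => by positivity) (fun _ => one_pos) (fun _ => le_rfl)
    hd (by simpa using summable_geometric_two)
  have hball : ∀ n x, b n x ≠ 0 → ‖x - z n‖ < R := fun n x hx => by
    have := hbs n (subset_tsupport _ hx)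
    rwa [mem_ball_iff_norm, mul_one] at this
  refine ⟨_, contDiff_tsum_of_finite_on_balls hb ?_, hmem.1, ?_,
    tendsto_levelFunctional_top ht fun n lam hlam => hlev n lam (by simpa using hlam)⟩
  · intro ρ
    obtain ⟨n₀, hn₀⟩ := exists_nat_ge (ρ + R)
    refine ⟨n₀, fun n hn x hx => by_contra fun hne => ?_⟩
    have h1 := hball n x hne
    have h2 := norm_sub_norm_le (z n) x
    rw [hz, norm_sub_rev] at h2
    have h3 : (n₀ : ℝ) ≤ n := by exact_mod_cast hn
    nlinarith
  · intro k
    obtain ⟨B, hB⟩ := (tendsto_pow_const_mul_const_pow_of_lt_one k (r := 1 / 2) (by norm_num)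
      (by norm_num)).bddAbove_range
    have hB' : ∀ n : ℕ, (n : ℝ) ^ k * (1 / 2) ^ n ≤ B := fun n => hB ⟨n, rfl⟩
    have hB0 : 0 ≤ B := le_trans (by positivity) (hB' 0)
    refine ⟨(3 * R) ^ k * (2 * B), fun x => ?_⟩
    obtain ⟨n, hn⟩ := exists_forall_notMem_of_disjoint hd x
    have hu : ∑' n, b n x = b n x := tsum_eq_single n fun m hm =>
      image_eq_zero_of_notMem_tsupport fun h => hn m hm (hbs m h)
    dsimp only
    rw [hu]
    by_cases hx : b n x = 0
    · rw [hx, abs_zero, mul_zero]; positivity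
    -- The `n`-th bump lives at distance of order at most `n + 1` and has height at most `2^(-n)`,
    -- which beats every power.
    · have h1 : ‖x‖ ≤ 3 * R * (n + 1 : ℕ) := by
        have h2 := norm_sub_norm_le x (z n)
        rw [hz] at h2
        have h3 := hball n x hx
        push_cast
        have : (0 : ℝ) ≤ n := by positivity
        nlinarith
      calc ‖x‖ ^ k * |b n x| ≤ (3 * R * (n + 1 : ℕ)) ^ k * (1 / 2) ^ n := by
            gcongr
            exact hbA n x
        _ = (3 * R) ^ k * (2 * (((n + 1 : ℕ) : ℝ) ^ k * (1 / 2) ^ (n + 1))) := by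
            rw [mul_pow, pow_succ (1 / 2 : ℝ)]; ring
        _ ≤ _ := by
            gcongr
            exact hB' (n + 1)

/-- Compactly supported superpositions, with prescribed radii and amplitudes. -/
theorem exists_compactly_supported_superposition {N : ℕ} (hN : 1 ≤ N) {γ : ℝ} (hγ : -1 ≤ γ)
    (hγ0 : γ < 0) :
    ∃ R t : ℝ, 1 ≤ R ∧ 0 < t ∧ ∀ A r K : ℕ → ℝ, (∀ n, 0 < A n) → (∀ n, 0 < r n) →
      (∀ n, r n ≤ (1 / 2) ^ n / (4 * R)) → (∀ n, A n * r n ^ (N - 1) ≤ (1 / 2) ^ n) →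
      ∃ u : Eu N → ℝ, MemW11 u ∧ HasCompactSupport u ∧
        ∀ n lam, lam * r n ^ (1 + γ) ≤ t * A n →
          ENNReal.ofReal (K n) ≤ nu N γ (superlevel lam γ u) := by
  obtain ⟨R, t, hR, ht, H⟩ := exists_superposition hN hγ hγ0
  refine ⟨R, t, hR, ht, fun A r K hA hr hrs hs => ?_⟩
  let e : Eu N := EuclideanSpace.single ⟨0, hN⟩ 1
  have he : ‖e‖ = 1 := by simp [e]
  have hp1 : ∀ n : ℕ, (1 / 2 : ℝ) ^ n ≤ 1 := fun n => pow_le_one₀ (by norm_num) (by norm_num)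
  have hRr : ∀ n, R * r n ≤ (1 / 2) ^ n / 4 := fun n => by
    calc R * r n ≤ R * ((1 / 2) ^ n / (4 * R)) := by gcongr; exact hrs n
      _ = _ := by field_simp
  -- The centres `2^(-n) e` are at least `2^(-n-1)` apart, and each ball has radius at most a
  -- quarter of `2^(-n)`.
  have hlt : ∀ n m : ℕ, n < m → R * r n + R * r m ≤ |(1 / 2 : ℝ) ^ n - (1 / 2) ^ m| := by
    intro n m hnm
    have h1 : (1 / 2 : ℝ) ^ m ≤ (1 / 2) ^ (n + 1) :=
      pow_le_pow_of_le_one (by norm_num) (by norm_num) hnm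
    rw [pow_succ] at h1
    have h2 : (0 : ℝ) < (1 / 2) ^ n := by positivity
    refine le_trans ?_ (le_abs_self _)
    linarith [hRr n, hRr m]
  have hdist : ∀ n m : ℕ, dist ((1 / 2 : ℝ) ^ n • e) ((1 / 2 : ℝ) ^ m • e) =
      |(1 / 2 : ℝ) ^ n - (1 / 2) ^ m| := fun n m => by
    rw [dist_eq_norm, ← sub_smul, norm_smul, he, mul_one, Real.norm_eq_abs]
  obtain ⟨b, -, hbs, -, hmem, hlev⟩ := H A r K (fun n => (1 / 2 : ℝ) ^ n • e) hA hr
    (fun n => by nlinarith [hRr n, hp1 n, hr n])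
    (fun n m hnm => Metric.ball_disjoint_ball (by
      rw [hdist]
      rcases lt_or_gt_of_ne hnm with h | h
      · exact hlt n m h
      · rw [add_comm, abs_sub_comm]; exact hlt m n h))
    (summable_geometric_two.of_nonneg_of_le
      (fun n => mul_nonneg (hA n).le (pow_nonneg (hr n).le _)) hs)
  refine ⟨_, hmem, ?_, hlev⟩
  refine HasCompactSupport.of_support_subset_isCompact (isCompact_closedBall (0 : Eu N) 2) ?_
  intro x hx
  obtain ⟨n, hn⟩ : ∃ n, b n x ≠ 0 := by
    by_contra hcon
    push Not at hcon
    exact hx (by simp [hcon])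
  have h1 := hbs n (subset_tsupport _ hn)
  rw [mem_ball_iff_norm] at h1
  have h2 := norm_sub_norm_le x ((1 / 2 : ℝ) ^ n • e)
  rw [norm_smul, he, mul_one, Real.norm_of_nonneg (by positivity)] at h2
  rw [mem_closedBall_zero_iff]
  linarith [hRr n, hp1 n]

theorem exists_compactly_supported_tendsto_top {N : ℕ} (hN : 1 ≤ N) {γ : ℝ} (hγ : -1 ≤ γ)
    (hγ0 : γ < 0) :
    ∃ u : Eu N → ℝ, MemW11 u ∧ HasCompactSupport u ∧
      Tendsto (levelFunctional γ u) (𝓝[>] 0) (𝓝 ⊤) := by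
  obtain ⟨R, t, hR, ht, H⟩ := exists_compactly_supported_superposition hN hγ hγ0
  let r : ℕ → ℝ := fun n => (1 / 2) ^ n / (4 * R)
  have hr : ∀ n, 0 < r n := fun n => by positivity
  have hr1 : ∀ n, r n ≤ 1 := fun n => by
    refine div_le_one_of_le₀ ?_ (by positivity)
    have : (1 / 2 : ℝ) ^ n ≤ 1 := pow_le_one₀ (by norm_num) (by norm_num)
    linarith
  -- This amplitude places the level of the `n`-th bump exactly at `t 2^(-n)`.
  obtain ⟨u, hu, huc, hlev⟩ := H (fun n => (1 / 2) ^ n * r n ^ (1 + γ)) r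
    (fun n => n * 2 ^ (n + 1) / t)
    (fun n => mul_pos (by positivity) (Real.rpow_pos_of_pos (hr n) _)) hr (fun n => le_rfl)
    (fun n => by
      have h1 : r n ^ (1 + γ) ≤ 1 := Real.rpow_le_one (hr n).le (hr1 n) (by linarith)
      have h2 : r n ^ (N - 1) ≤ 1 := pow_le_one₀ (hr n).le (hr1 n)
      rw [mul_assoc]
      exact mul_le_of_le_one_right (by positivity)
        (mul_le_one₀ h1 (pow_nonneg (hr n).le _) h2))
  refine ⟨u, hu, huc, tendsto_levelFunctional_top ht fun n lam hlam => hlev n lam ?_⟩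
  rw [← mul_assoc]
  exact mul_le_mul_of_nonneg_right hlam (Real.rpow_nonneg (hr n).le _)

theorem exists_compactly_supported_eq_top {N : ℕ} (hN : 1 ≤ N) {γ : ℝ} (hγ : -1 ≤ γ)
    (hγ0 : γ < 0) (hNγ : 0 < N + γ) :
    ∃ u : Eu N → ℝ, MemW11 u ∧ HasCompactSupport u ∧
      ∀ lam : ℝ, nu N γ (superlevel lam γ u) = ⊤ := by
  obtain ⟨R, t, hR, ht, H⟩ := exists_compactly_supported_superposition hN hγ hγ0
  have hex : ∀ n : ℕ, ∃ r : ℝ, 0 < r ∧ r ≤ (1 / 2) ^ n / (4 * R) ∧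
      (n + 1) * r ^ (N + γ) ≤ (1 / 2) ^ n := by
    intro n
    have h1 : Tendsto (fun r : ℝ => (n + 1) * r ^ (N + γ)) (𝓝[>] 0) (𝓝 ((n + 1) * 0 ^ (N + γ))) :=
      (((Real.continuousAt_rpow_const 0 (N + γ) (Or.inr hNγ.le)).tendsto).mono_left
        nhdsWithin_le_nhds).const_mul _
    rw [Real.zero_rpow hNγ.ne', mul_zero] at h1
    have h2 : (0 : ℝ) < (1 / 2) ^ n := by positivity
    have h3 : (0 : ℝ) < (1 / 2) ^ n / (4 * R) := by positivity
    obtain ⟨r, hr1, hr2⟩ := ((h1.eventually (gt_mem_nhds h2)).and (Ioo_mem_nhdsGT h3)).exists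
    exact ⟨r, hr2.1, hr2.2.le, hr1.le⟩
  choose r hr hrs hrA using hex
  -- The level of the `n`-th bump is `t (n + 1)`, so any given `lam` lies below all but finitely
  -- many levels; the gradient cost `(n + 1) r^(N+γ)` is small by the choice of `r`.
  obtain ⟨u, hu, huc, hlev⟩ := H (fun n => (n + 1) * r n ^ (1 + γ)) r (fun n => n)
    (fun n => mul_pos (by positivity) (Real.rpow_pos_of_pos (hr n) _)) hr hrs
    (fun n => by
      refine le_trans (le_of_eq ?_) (hrA n)
      rw [mul_assoc, ← Real.rpow_natCast, ← Real.rpow_add (hr n), Nat.cast_sub hN]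
      congr 2
      push_cast
      ring)
  refine ⟨u, hu, huc, fun lam => ?_⟩
  obtain ⟨n₀, hn₀⟩ := exists_nat_ge (lam / t)
  rw [div_le_iff₀ ht] at hn₀
  refine ENNReal.eq_top_of_forall_nnreal_le fun c => ?_
  obtain ⟨n₁, hn₁⟩ := exists_nat_ge c
  refine le_trans ?_ (hlev (max n₀ n₁) lam ?_)
  · rw [ENNReal.ofReal_natCast]
    exact_mod_cast hn₁.trans (by exact_mod_cast le_max_right n₀ n₁)
  · rw [← mul_assoc]
    refine mul_le_mul_of_nonneg_right ?_ (Real.rpow_nonneg (hr _).le _)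
    have : (n₀ : ℝ) ≤ (max n₀ n₁ : ℕ) := by exact_mod_cast le_max_left n₀ n₁
    nlinarith

/-! ### Meagreness -/

theorem superlevel_anti {N : ℕ} {lam mu b : ℝ} (h : lam ≤ mu) (u : Eu N → ℝ) :
    superlevel mu b u ⊆ superlevel lam b u :=
  fun _ hp => ⟨hp.1, h.trans_lt hp.2⟩

theorem superlevel_smul {N : ℕ} {lam b c : ℝ} (hc : 0 < c) (u : Eu N → ℝ) :
    superlevel lam b (c • u) = superlevel (lam / c) b u := by
  ext p
  refine and_congr_right fun _ => ?_
  have : Q b (c • u) p.1 p.2 = c * Q b u p.1 p.2 := by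
    simp only [Q, Pi.smul_apply, smul_eq_mul]; ring
  rw [this, abs_mul, abs_of_pos hc, div_lt_iff₀' hc]

theorem superlevel_two_mul_subset {N : ℕ} {lam b : ℝ} (u w : Eu N → ℝ) :
    superlevel (2 * lam) b w ⊆ superlevel lam b (u + w) ∪ superlevel lam b u := by
  rintro p ⟨hne, hp⟩
  by_contra hcon
  simp only [Set.mem_union, not_or] at hcon
  have h1 : |Q b (u + w) p.1 p.2| ≤ lam := not_lt.1 fun h => hcon.1 ⟨hne, h⟩
  have h2 : |Q b u p.1 p.2| ≤ lam := not_lt.1 fun h => hcon.2 ⟨hne, h⟩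
  have e : Q b w p.1 p.2 = Q b (u + w) p.1 p.2 - Q b u p.1 p.2 := by
    simp only [Q, Pi.add_apply]; ring
  rw [e] at hp
  linarith [abs_sub (Q b (u + w) p.1 p.2) (Q b u p.1 p.2)]

theorem nu_absolutelyContinuous (N : ℕ) (γ : ℝ) :
    nu N γ ≪ (volume : Measure (Eu N)).prod volume :=
  (withDensity_absolutelyContinuous _ _).trans
    (Measure.absolutelyContinuous_of_le Measure.restrict_le_self)

theorem ae_nu_of_ae {N : ℕ} {γ : ℝ} {P : Eu N → Prop} (h : ∀ᵐ x, P x) :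
    ∀ᵐ p ∂nu N γ, P p.1 ∧ P p.2 :=
  (nu_absolutelyContinuous N γ).ae_le
    ((Measure.quasiMeasurePreserving_fst.ae h).and (Measure.quasiMeasurePreserving_snd.ae h))

theorem nu_superlevel_congr {N : ℕ} {γ lam b : ℝ} {u v : Eu N → ℝ} (h : u =ᵐ[volume] v) :
    nu N γ (superlevel lam b u) = nu N γ (superlevel lam b v) := by
  refine measure_congr ?_
  filter_upwards [ae_nu_of_ae (γ := γ) h] with p hp
  have : (p ∈ superlevel lam b u) = (p ∈ superlevel lam b v) := by
    simp only [superlevel, Q, Set.mem_ofPred_eq, hp.1, hp.2]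
  exact this

/-- Fatou for sets: the strict inequality defining the superlevel set of `v` persists for all large
`k`, so up to a null set it lies in the lower limit of the superlevel sets of `u k`. -/
theorem nu_superlevel_le_of_tendsto {N : ℕ} {γ lam b : ℝ} {u : ℕ → Eu N → ℝ} {v : Eu N → ℝ}
    (h : ∀ᵐ x, Tendsto (fun k => u k x) atTop (𝓝 (v x))) {B : ℝ≥0∞}
    (hB : ∀ k, nu N γ (superlevel lam b (u k)) ≤ B) : nu N γ (superlevel lam b v) ≤ B := by
  have hmono : Monotone fun m : ℕ => ⋂ k ≥ m, superlevel lam b (u k) := fun m n hmn =>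
    Set.biInter_subset_biInter_left fun k (hk : n ≤ k) => hmn.trans hk
  have hle : nu N γ (superlevel lam b v) ≤ nu N γ (⋃ m, ⋂ k ≥ m, superlevel lam b (u k)) := by
    refine measure_mono_ae ?_
    filter_upwards [ae_nu_of_ae (γ := γ) h] with p hp hpv
    have ht : Tendsto (fun k => |Q b (u k) p.1 p.2|) atTop (𝓝 |Q b v p.1 p.2|) :=
      ((hp.1.sub hp.2).div_const _).abs
    obtain ⟨m, hm⟩ := eventually_atTop.1 (ht.eventually (lt_mem_nhds hpv.2))
    exact Set.mem_iUnion.2 ⟨m, Set.mem_iInter₂.2 fun k hk => ⟨hpv.1, hm k hk⟩⟩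
  refine hle.trans ?_
  rw [hmono.measure_iUnion]
  exact iSup_le fun m => (measure_mono (Set.biInter_subset_of_mem (le_refl m))).trans (hB m)

theorem W11.toFun_add_smul {N : ℕ} (U W : W11 N) (c : ℝ) :
    W11.toFun (U + c • W) =ᵐ[volume] W11.toFun U + c • W11.toFun W := by
  refine (Lp.coeFn_add _ _).trans ?_
  filter_upwards [Lp.coeFn_smul c (W : WithLp 1 (Lp ℝ 1 (volume : Measure (Eu N)) ×
    Lp (Eu N) 1 (volume : Measure (Eu N)))).fst] with x hx
  simp only [Pi.add_apply, W11.toFun]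
  exact congrArg _ hx

theorem MemW11.exists_toFun_ae_eq {N : ℕ} {u : Eu N → ℝ} (hu : MemW11 u) :
    ∃ W : W11 N, W11.toFun W =ᵐ[volume] u := by
  obtain ⟨⟨-, g, hg, hw⟩, hi⟩ := hu
  exact ⟨⟨WithLp.toLp 1 (hi.toL1 u, hg.toL1 g),
    hw.congr hi.coeFn_toL1.symm hg.coeFn_toL1.symm⟩, hi.coeFn_toL1⟩

/-- Convergence in `W^{1,1}` gives `L¹` convergence of the functions, hence almost everywhere
convergence along a subsequence. -/
theorem isClosed_setOf_nu_superlevel_le {N : ℕ} (γ lam : ℝ) (B : ℝ≥0∞) :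
    IsClosed {U : W11 N | nu N γ (superlevel lam γ (W11.toFun U)) ≤ B} := by
  refine IsSeqClosed.isClosed fun U V hU hUV => ?_
  have hfst : Tendsto (fun k => (U k : WithLp 1 (Lp ℝ 1 (volume : Measure (Eu N)) ×
      Lp (Eu N) 1 (volume : Measure (Eu N)))).fst) atTop (𝓝 (V : WithLp 1 (Lp ℝ 1
      (volume : Measure (Eu N)) × Lp (Eu N) 1 (volume : Measure (Eu N)))).fst) :=
    ((WithLp.continuous_fst 1 _ _).comp continuous_subtype_val).continuousAt.tendsto.comp hUV
  obtain ⟨ns, -, hns⟩ := (tendstoInMeasure_of_tendsto_Lp hfst).exists_seq_tendsto_ae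
  exact nu_superlevel_le_of_tendsto hns fun k => hU (ns k)

/-- If the bounds `B` are violated by all small multiples of some `W`, then the set of functions
that satisfy them is nowhere dense. -/
theorem isNowhereDense_setOf_nu_superlevel_le {N : ℕ} {γ : ℝ} (L : Set ℝ) (B : ℝ → ℝ≥0∞) (W : W11 N)
    (hW : ∀ c : ℝ, 0 < c → ∃ lam ∈ L,
      2 * B lam < nu N γ (superlevel (2 * lam / c) γ (W11.toFun W))) :
    IsNowhereDense {U : W11 N | ∀ lam ∈ L, nu N γ (superlevel lam γ (W11.toFun U)) ≤ B lam} := by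
  have hclosed : IsClosed
      {U : W11 N | ∀ lam ∈ L, nu N γ (superlevel lam γ (W11.toFun U)) ≤ B lam} := by
    have e : {U : W11 N | ∀ lam ∈ L, nu N γ (superlevel lam γ (W11.toFun U)) ≤ B lam} =
        ⋂ lam ∈ L, {U : W11 N | nu N γ (superlevel lam γ (W11.toFun U)) ≤ B lam} := by
      ext U; simp
    rw [e]
    exact isClosed_biInter fun lam _ => isClosed_setOf_nu_superlevel_le γ lam (B lam)
  rw [hclosed.isNowhereDense_iff, Set.eq_empty_iff_forall_notMem]
  intro U hU
  have hcont : Tendsto (fun c : ℝ => U + c • W) (𝓝[>] 0) (𝓝 U) := by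
    have : Continuous fun c : ℝ => U + c • W := by fun_prop
    simpa using (this.tendsto 0).mono_left nhdsWithin_le_nhds
  obtain ⟨c, hcU, hc⟩ := ((hcont.eventually (mem_interior_iff_mem_nhds.1 hU)).and
    self_mem_nhdsWithin).exists
  have hc : 0 < c := hc
  obtain ⟨lam, hlam, hlt⟩ := hW c hc
  have h1 := hcU lam hlam
  have h2 := interior_subset hU lam hlam
  rw [nu_superlevel_congr (W11.toFun_add_smul U W c)] at h1
  rw [← superlevel_smul hc] at hlt
  refine absurd hlt (not_lt.2 ?_)
  -- Both `U` and `U + c W` satisfy the bounds, so by subadditivity their difference `c W` obeys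
  -- twice the bound at twice the level.
  calc _ ≤ _ := measure_mono (superlevel_two_mul_subset (W11.toFun U) (c • W11.toFun W))
    _ ≤ _ := measure_union_le _ _
    _ ≤ B lam + B lam := add_le_add h1 h2
    _ = 2 * B lam := (two_mul _).symm

theorem isMeagre_setOf_limsup_lt_top {N : ℕ} {γ : ℝ} {u : Eu N → ℝ} (hu : MemW11 u)
    (htop : Tendsto (levelFunctional γ u) (𝓝[>] 0) (𝓝 ⊤)) :
    IsMeagre {U : W11 N | limsup (levelFunctional γ (W11.toFun U)) (𝓝[>] 0) < ⊤} := by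
  obtain ⟨W, hW⟩ := hu.exists_toFun_ae_eq
  -- A single integer `m` serves both as the bound for `lam ν_γ` and as the range of `lam`;
  -- increasing it weakens both conditions.
  refine IsMeagre.mono (s := ⋃ m : ℕ, {U : W11 N | ∀ lam ∈ Set.Ioo (0 : ℝ) (1 / (m + 1)),
    nu N γ (superlevel lam γ (W11.toFun U)) ≤ ENNReal.ofReal (m / lam)}) ?_
    (isMeagre_iUnion fun m => (isNowhereDense_setOf_nu_superlevel_le _ _ W ?_).isMeagre)
  · intro U hU
    obtain ⟨a, ha, haT⟩ := exists_between
      (show limsup (levelFunctional γ (W11.toFun U)) (𝓝[>] 0) < ⊤ from hU)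
    obtain ⟨n, hn⟩ := ENNReal.exists_nat_gt haT.ne
    obtain ⟨ε, hε, hev⟩ := mem_nhdsGT_iff_exists_Ioo_subset.1 (eventually_lt_of_limsup_lt ha)
    obtain ⟨m, hm⟩ := exists_nat_one_div_lt (show (0 : ℝ) < ε from hε)
    refine Set.mem_iUnion.2 ⟨max n m, fun lam hlam => ?_⟩
    have hmm : (1 : ℝ) / ((max n m : ℕ) + 1) ≤ 1 / (m + 1) := by
      gcongr
      exact_mod_cast le_max_right n m
    have h1 : levelFunctional γ (W11.toFun U) lam < a :=
      hev ⟨hlam.1, hlam.2.trans_le (hmm.trans hm.le)⟩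
    have h0 : ENNReal.ofReal lam ≠ 0 := by simpa using hlam.1
    rw [ENNReal.ofReal_div_of_pos hlam.1, ENNReal.ofReal_natCast,
      ENNReal.le_div_iff_mul_le (Or.inl h0) (Or.inl ENNReal.ofReal_ne_top), mul_comm]
    exact (h1.le.trans hn.le).trans (by exact_mod_cast le_max_left n m)
  · intro c hc
    have h1 : Tendsto (fun lam : ℝ => 2 * lam / c) (𝓝[>] 0) (𝓝[>] 0) := by
      refine tendsto_nhdsWithin_iff.2 ⟨?_, ?_⟩
      · have : Continuous fun lam : ℝ => 2 * lam / c := by fun_prop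
        simpa using (this.tendsto 0).mono_left nhdsWithin_le_nhds
      · filter_upwards [self_mem_nhdsWithin] with lam hlam
        exact div_pos (mul_pos two_pos hlam) hc
    -- The threshold `4m/c` is the level `2 lam / c` times twice the bound `m / lam`.
    obtain ⟨lam, hlt, hlam⟩ := (((htop.comp h1).eventually
      (lt_mem_nhds (ENNReal.ofReal_lt_top (r := 4 * m / c)))).and
      (Ioo_mem_nhdsGT (show (0 : ℝ) < 1 / (m + 1) by positivity))).exists
    refine ⟨lam, hlam, ?_⟩
    rw [nu_superlevel_congr hW]
    by_contra hcon
    refine absurd hlt (not_lt.2 ?_)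
    have hpos : 0 < lam := hlam.1
    calc levelFunctional γ u (2 * lam / c)
        ≤ ENNReal.ofReal (2 * lam / c) * (2 * ENNReal.ofReal (m / lam)) := by
          rw [levelFunctional]; gcongr; exact not_lt.1 hcon
      _ = ENNReal.ofReal (4 * m / c) := by
          rw [← ENNReal.ofReal_ofNat 2, ← ENNReal.ofReal_mul (by norm_num),
            ← ENNReal.ofReal_mul (by positivity)]
          congr 1
          field_simp
          ring

theorem isMeagre_setOf_nu_lt_top {N : ℕ} {γ : ℝ} {u : Eu N → ℝ} (hu : MemW11 u)
    (htop : ∀ lam : ℝ, nu N γ (superlevel lam γ u) = ⊤) :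
    IsMeagre {U : W11 N | ∃ lam : ℝ, 0 < lam ∧ nu N γ (superlevel lam γ (W11.toFun U)) < ⊤} := by
  obtain ⟨W, hW⟩ := hu.exists_toFun_ae_eq
  -- Superlevel sets shrink as `lam` grows, so integer levels suffice and the same integer can bound
  -- the measure.
  refine IsMeagre.mono (s := ⋃ m : ℕ, {U : W11 N | ∀ lam ∈ ({(m : ℝ)} : Set ℝ),
    nu N γ (superlevel lam γ (W11.toFun U)) ≤ (m : ℝ≥0∞)}) ?_
    (isMeagre_iUnion fun m =>
      (isNowhereDense_setOf_nu_superlevel_le _ (fun _ => (m : ℝ≥0∞)) W ?_).isMeagre)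
  · rintro U ⟨lam, -, hlt⟩
    obtain ⟨n, hn⟩ := ENNReal.exists_nat_gt hlt.ne
    obtain ⟨m, hm⟩ := exists_nat_ge lam
    refine Set.mem_iUnion.2 ⟨max n m, ?_⟩
    rintro _ rfl
    refine (measure_mono (superlevel_anti (hm.trans (by exact_mod_cast le_max_right n m)) _)).trans
      (hn.le.trans (by exact_mod_cast le_max_left n m))
  · intro c _
    refine ⟨m, rfl, ?_⟩
    rw [nu_superlevel_congr hW, htop]
    exact ENNReal.mul_lt_top (by simp) (by simp)

end SobolevCounterexamples

end

open SobolevCounterexamples in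
theorem theorem1p8 (N : ℕ) (hN : 1 ≤ N) (γ : ℝ) (hγ : -1 ≤ γ) (hγ0 : γ < 0) :
    -- (i)
    (∃ u : Eu N → ℝ, ContDiff ℝ ∞ u ∧ MemHomW11 u ∧ RapidlyDecreasing u ∧
      Tendsto (levelFunctional γ u) (𝓝[>] 0) (𝓝 ⊤)) ∧
    -- (ii)
    ((∃ u : Eu N → ℝ, MemW11 u ∧ HasCompactSupport u ∧
        Tendsto (levelFunctional γ u) (𝓝[>] 0) (𝓝 ⊤)) ∧
      IsMeagre {U : W11 N | limsup (levelFunctional γ (W11.toFun U)) (𝓝[>] 0) < ⊤}) ∧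
    -- (iii)
    ((2 ≤ N ∨ -1 < γ) →
      (∃ u : Eu N → ℝ, MemW11 u ∧ HasCompactSupport u ∧
        ∀ lam : ℝ, 0 < lam → nu N γ (superlevel lam γ u) = ⊤) ∧
      IsMeagre {U : W11 N | ∃ lam : ℝ, 0 < lam ∧ nu N γ (superlevel lam γ (W11.toFun U)) < ⊤}) := by
  refine ⟨exists_smooth_counterexample hN hγ hγ0, ?_, fun h => ?_⟩
  · obtain ⟨u, hu, huc, htop⟩ := exists_compactly_supported_tendsto_top hN hγ hγ0
    exact ⟨⟨u, hu, huc, htop⟩, isMeagre_setOf_limsup_lt_top hu htop⟩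
  · have hNγ : 0 < N + γ := by
      rcases h with h | h
      · have : (2 : ℝ) ≤ N := by exact_mod_cast h
        linarith
      · have : (1 : ℝ) ≤ N := by exact_mod_cast hN
        linarith
    obtain ⟨u, hu, huc, htop⟩ := exists_compactly_supported_eq_top hN hγ hγ0 hNγ
    exact ⟨⟨u, hu, huc, fun lam _ => htop lam⟩, isMeagre_setOf_nu_lt_top hu htop⟩
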